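/- **Setting.** All registers consist of qubits, bitstrings are added modulo 2, $\Pi_t=|t\rangle\langle t|$ denotes a computational-basis projector, a Pauli channel is a map $\rho\mapsto\sum_P\mu_P\,P\rho P$ with $\mu$ a probability distribution on the Pauli operators $\{I,X,Y,Z\}^{\otimes n}$, and $f(P)$ denotes the bitstring with $P\Pi_tP=\Pi_{t+f(P)}$. We describe a stabilizer code in its Clifford frame by a logical register $L$ of $k$ qubits ($D=2^k$) and a syndrome register $S$, whose bitstrings are the syndromes; $s_*$ is the default syndrome. *QEC cycle.* A noisy QEC cycle uses an ancilla register $A$ and an outcome register $O$. A Clifford unitary $C$ on $S,A,O$ acts as $C(\Pi_t\otimes\Pi_a\otimes\Pi_0)C^\dagger=\Pi_t\otimes\Pi_{b(t)}\otimes\Pi_{E(t)}$ for all syndromes $t$; then a Pauli channel with probabilities $\mu_P$, $P=P_\ell\otimes P_s\otimes P_a\otimes P_o$, acts on $L,S,A,O$; then $O$ is read in the computational basis, giving $\theta$, and with $s_{\rm err}=\mathcal D(\theta)+s_*$ ($\mathcal D$ any decoding function) one applies $X^{s_{\rm err}}$ to $S$ and the Pauli correction $\mathcal C_{s_{\rm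 err}}$ to $L$ ($\mathcal C_0=\mathrm{id}$); finally $A$ and $O$ are discarded. The cycle may be modified by syndrome-state randomization: before $C$, a uniformly random $X^{r}$ is applied to $S$, and the logical correction is $\mathcal C_{s_{\rm err}+r}$ while the reset is unchanged (otherwise $r=0$). On $\rho_L\otimes\Pi_{s_{\rm in}}$ the cycle acts as $$\rho_L\otimes\Pi_{s_{\rm in}}\mapsto\sum_{s_{\rm out}}\gamma_{s_{\rm out},s_{\rm in}}\,\Lambda_{s_{\rm out},s_{\rm in}}(\rho_L)\otimes\Pi_{s_{\rm out}},$$ where $\gamma_{s_{\rm out},s_{\rm in}}$ is the probability, over $r$ and $P$, that $s_{\rm in}+r+f(P_s)+s_{\rm err}=s_{\rm out}$ with $s_{\rm err}=\mathcal D(E(s_{\rm in}+r)+f(P_o))+s_*$, and $\Lambda_{s_{\rm out},s_{\rm in}}$ is the corresponding conditional average of $\mathcal C_{s_{\rm err}+r}\circ(P_\ell\cdot P_\ell)$ (zero if $\gamma_{s_{\rm out},s_{\rm in}}=0$). The cycle has the *syndrome marginal independence property* if $\gamma_{s_{\rm out},s_{\rm in}}=:\gamma_{s_{\rm out}}$ does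 not depend on $s_{\rm in}$. In that case let $$\Lambda_1=\sum_{s_{\rm out},s_{\rm in}}\gamma_{s_{\rm out}}\gamma_{s_{\rm in}}\;\mathcal C_{s_{\rm out}+s_*}\circ\Lambda_{s_{\rm out},s_{\rm in}}\circ\mathcal C_{s_{\rm in}+s_*}^\dagger ,\qquad f_1=\frac1{D^3}\sum_{P}\operatorname{tr}\big(P\,\Lambda_1(P)\big),$$ the sum running over the Pauli operators $P$ of $L$; $f_1$ is the *single-cycle logical entanglement fidelity*. *Preparations.* A preparation $p$ consists of a logical density matrix $\sigma_L$ and a Pauli channel applied to $\sigma_L\otimes\Pi_{s_*}$. The result is $\sum_t\gamma^{\rm prep}_t\Lambda^{\rm prep}_t(\sigma_L)\otimes\Pi_t$, with $\gamma^{\rm prep}$ the distribution of the syndrome and $\Lambda^{\rm prep}_t$ the conditional logical Pauli channel. *Measurements.* A measurement $m$ consists of a logical Clifford unitary $V$, with target POVM $M_x=V^\dagger\Pi_xV$; a Clifford unitary $C_{\rm meas}$ on $L,S$ and fresh registers $A,O$ with $C_{\rm meas}(V^\dagger|x\rangle\otimes|t\rangle\otimes|a\rangle\otimes|0\rangle)=|x\rangle\otimes|t\rangle\otimes|b(x,t)\rangle\otimes|E_m(x,t)\rangle$;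 a Pauli channel on $L,S,A,O$ after it; and a function $\mathcal D_m$ that turns the content of $O$ into the outcome. $\Lambda^{\rm meas}_t$ is the logical channel $\rho\mapsto\sum_{x,y}q_t(x|y)\operatorname{tr}(M_y\rho)\,M_x$, where $q_t(x|y)$ is the probability that $\mathcal D_m(E_m(y,t)+f(P_o))=x$; thus $\operatorname{tr}(M_x\Lambda^{\rm meas}_t(\rho))$ is the probability of the outcome $x$ on $\rho\otimes\Pi_t$. *Experiments and models.* A set of experimental settings is a set $\mathsf{Exp}$ of pairs $(p,m)$. The experiment with setting $(p,m)$ and $K\ge1$ cycles performs $p$, then $K$ times the cycle, then $m$. Its total logical error channel is $$\Lambda^{(K)}_{p,m}=\sum_{s_0,\dots,s_K}\gamma_{s_K,s_{K-1}}\cdots\gamma_{s_1,s_0}\gamma^{\rm prep}_{s_0}\;\Lambda^{\rm meas}_{s_K}\circ\Lambda_{s_K,s_{K-1}}\circ\cdots\circ\Lambda_{s_1,s_0}\circ\Lambda^{\rm prep}_{s_0}.$$ A logical Markovian model consists of linear superoperators $\Phi_{{\rm prep},p}$, $\Phi_{\rm QEC}$, $\Phi_{{\rm meas},m}$ on the operators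 of $L$, with $\Phi_{\rm QEC}$ independent of the setting. For $G>0$ and $0<\epsilon<1$ it is a *$(G,\epsilon)$-approximate* logical Markovian model for $\mathsf{Exp}$ if for all $(p,m)\in\mathsf{Exp}$, all $K\ge1$ and all outcomes $x$, $$\Big|\operatorname{tr}\big(M_x\,\Lambda^{(K)}_{p,m}(\sigma_L)\big)-\operatorname{tr}\big(M_x\,\Phi_{{\rm meas},m}\Phi_{\rm QEC}^K\Phi_{{\rm prep},p}(\sigma_L)\big)\Big|\le G\,\epsilon^K .$$ **Theorem.** Consider a fixed noisy QEC cycle as above that has the syndrome marginal independence property, and suppose $f_1\ge1-\epsilon_1$ with $0<\epsilon_1\le1/64$. Let $\mathsf{Exp}$ be a set of experimental settings such that $\gamma^{\rm prep}=\gamma$ (the syndrome marginal distribution of the cycle) for every preparation that occurs in $\mathsf{Exp}$. Put $$\epsilon=2(1+\sqrt2)\sqrt{\epsilon_1},\qquad G'=1+\frac1{1-\epsilon/(1-2\sqrt{\epsilon_1})},\qquad G=G'\sqrt D .$$ Then $G'<7$, and there is a $(G,\epsilon)$-approximate logical Markovian model for $\mathsf{Exp}$. Moreover, for every setting $(p,m)\in\mathsf{Exp}$,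 every $K\ge1$ and every $x$, the probability of the outcome $x$ in the experiment with $K$ cycles deviates from the model's prediction $\operatorname{tr}(M_x\Phi_{{\rm meas},m}\Phi_{\rm QEC}^K\Phi_{{\rm prep},p}(\sigma_L))$ by at most $G\epsilon^K$. -/

import Mathlib

open scoped Matrix Kronecker ComplexOrder

namespace QEC

/-! ### Bitstrings, Pauli operators, superoperators -/

/-- Bitstrings of an `n`-qubit register; addition is bitwise XOR.
They label the computational basis. -/
abbrev Bits (n : ℕ) : Type := Fin n → ZMod 2

/-- Labels of the single-qubit Pauli operators. -/
inductive Pauli1 : Type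
  | I | X | Y | Z
  deriving DecidableEq

instance : Fintype Pauli1 where
  elems := {.I, .X, .Y, .Z}
  complete := by rintro (_ | _ | _ | _) <;> decide

/-- The `2 × 2` Pauli matrices, with rows and columns labelled by a bit. -/
noncomputable def Pauli1.mat : Pauli1 → Matrix (ZMod 2) (ZMod 2) ℂ
  | .I => 1
  | .X => Matrix.of fun a b => if a = b + 1 then 1 else 0
  | .Y => Matrix.of fun a b =>
      if a = b + 1 then (if b = 0 then Complex.I else -Complex.I) else 0
  | .Z => Matrix.of fun a b => if a = b then (if a = 0 then 1 else -1) else 0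

/-- Whether a single-qubit Pauli operator flips a computational-basis state. -/
def Pauli1.flip : Pauli1 → ZMod 2
  | .I => 0
  | .X => 1
  | .Y => 1
  | .Z => 0

/-- Labels of the `4 ^ n` Pauli operators on `n` qubits. -/
abbrev Pauli (n : ℕ) : Type := Fin n → Pauli1

/-- The Pauli operator `Q₁ ⊗ ⋯ ⊗ Qₙ` as a matrix in the computational basis. -/
noncomputable def Pauli.mat {n : ℕ} (P : Pauli n) : Matrix (Bits n) (Bits n) ℂ :=
  Matrix.of fun x y => ∏ j, (P j).mat (x j) (y j)

/-- The unique bitstring `t` with `P |s⟩⟨s| P = |s + t⟩⟨s + t|` for all `s`. -/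
def Pauli.flip {n : ℕ} (P : Pauli n) : Bits n := fun j => (P j).flip

/-- The bit-flip operator `X ^ t`. -/
def xPauli {n : ℕ} (t : Bits n) : Pauli n := fun j => if t j = 0 then Pauli1.I else Pauli1.X

/-- The projector `|s⟩⟨s|` onto a computational-basis state. -/
def proj {ι : Type*} [DecidableEq ι] (s : ι) : Matrix ι ι ℂ := Matrix.single s s 1

/-- Superoperators on the operators of an `n`-qubit register. -/
abbrev Superop (n : ℕ) : Type := Module.End ℂ (Matrix (Bits n) (Bits n) ℂ)

/-- The map `ρ ↦ K ρ K†`. -/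
def conjBy {m n : Type*} [Fintype m] [Fintype n] (K : Matrix m n ℂ) :
    Matrix n n ℂ →ₗ[ℂ] Matrix m m ℂ where
  toFun ρ := K * ρ * Kᴴ
  map_add' ρ ρ' := by rw [Matrix.mul_add, Matrix.add_mul]
  map_smul' z ρ := by simp

/-- The mixture `ρ ↦ ∑ i, μ i • (op i) ρ (op i)†`; it is the Pauli channel with mixture
probabilities `μ` when `op` is a family of Pauli operators. -/
noncomputable def mixture {ι n : Type*} [Fintype ι] [Fintype n] (op : ι → Matrix n n ℂ)
    (μ : ι → ℝ) : Module.End ℂ (Matrix n n ℂ) :=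
  ∑ i, (μ i : ℂ) • conjBy (op i)

/-- `U` is a Clifford unitary with respect to the Pauli operators `op i`: it is unitary and
conjugation by `U` maps each Pauli operator to plus or minus a Pauli operator. -/
def IsClifford {ι n : Type*} [Fintype n] [DecidableEq n] (op : ι → Matrix n n ℂ)
    (U : Matrix n n ℂ) : Prop :=
  U ∈ Matrix.unitaryGroup n ℂ ∧
    ∀ i, ∃ j, U * op i * Uᴴ = op j ∨ U * op i * Uᴴ = -op j

/-- Pauli operators on two registers. -/
noncomputable def pauli2 {k s : ℕ} (P : Pauli k × Pauli s) :
    Matrix (Bits k × Bits s) (Bits k × Bits s) ℂ :=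
  P.1.mat ⊗ₖ P.2.mat

/-- Pauli operators on three registers. -/
noncomputable def pauli3 {s a o : ℕ} (P : Pauli s × Pauli a × Pauli o) :
    Matrix (Bits s × Bits a × Bits o) (Bits s × Bits a × Bits o) ℂ :=
  P.1.mat ⊗ₖ pauli2 P.2

/-- Pauli operators on the four registers `L`, `S`, `A`, `O`. -/
noncomputable def pauli4 {k s a o : ℕ} (P : Pauli k × Pauli s × Pauli a × Pauli o) :
    Matrix (Bits k × Bits s × Bits a × Bits o) (Bits k × Bits s × Bits a × Bits o) ℂ :=
  P.1.mat ⊗ₖ pauli3 P.2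

/-- Adjoin `A` in the state `|a₀⟩⟨a₀|` and `O` in the state `|0⟩⟨0|` to a state of `L` and `S`. -/
def adjoin {k s a o : ℕ} (a₀ : Bits a) :
    Matrix (Bits k × Bits s) (Bits k × Bits s) ℂ →ₗ[ℂ]
      Matrix (Bits k × Bits s × Bits a × Bits o) (Bits k × Bits s × Bits a × Bits o) ℂ where
  toFun ρ := Matrix.of fun x y =>
    ρ (x.1, x.2.1) (y.1, y.2.1) * proj a₀ x.2.2.1 y.2.2.1 * proj (0 : Bits o) x.2.2.2 y.2.2.2
  map_add' ρ ρ' := by ext x y; simp [add_mul]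
  map_smul' z ρ := by ext x y; simp [mul_assoc]

/-- Discard `A` and `O` (partial trace). -/
def discard {k s a o : ℕ} :
    Matrix (Bits k × Bits s × Bits a × Bits o) (Bits k × Bits s × Bits a × Bits o) ℂ →ₗ[ℂ]
      Matrix (Bits k × Bits s) (Bits k × Bits s) ℂ where
  toFun ρ := Matrix.of fun x y =>
    ∑ u : Bits a, ∑ θ : Bits o, ρ (x.1, x.2, u, θ) (y.1, y.2, u, θ)
  map_add' ρ ρ' := by ext x y; simp [Finset.sum_add_distrib]
  map_smul' z ρ := by ext x y; simp [Finset.mul_sum]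

/-! ### QEC cycles with Pauli-stochastic noise -/

/-- A QEC cycle, in the Clifford frame, of a stabilizer code with `k` logical qubits (register
`L`) and `s` stabilizer generators (register `S`), together with its Pauli-stochastic noise. -/
structure Cycle (k s : ℕ) where
  /-- number of ancilla qubits (register `A`) -/
  a : ℕ
  /-- number of outcome qubits (register `O`) -/
  o : ℕ
  /-- default configuration `s_*` of the syndrome register -/
  sStar : Bits s
  /-- initial state of the ancillas -/
  a₀ : Bits a
  /-- the Clifford unitary `C` on `S`, `A`, `O` that reads out the syndrome information -/
  C : Matrix (Bits s × Bits a × Bits o) (Bits s × Bits a × Bits o) ℂ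
  clifford : IsClifford (pauli3 (s := s) (a := a) (o := o)) C
  /-- syndrome encoding function -/
  E : Bits s → Bits o
  /-- output state of the ancillas -/
  b : Bits s → Bits a
  readout : ∀ t : Bits s,
    conjBy C (proj (t, a₀, (0 : Bits o))) = proj (t, b t, E t)
  /-- syndrome decoding function -/
  D : Bits o → Bits s
  /-- the decoder: the logical Pauli correction for each error syndrome `s_err` -/
  cor : Bits s → Pauli k
  cor_zero : cor 0 = fun _ => Pauli1.I
  /-- mixture probabilities of the Pauli channel that acts directly after `C` -/
  noise : Pauli k × Pauli s × Pauli a × Pauli o → ℝ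
  noise_mem : noise ∈ stdSimplex ℝ (Pauli k × Pauli s × Pauli a × Pauli o)
  /-- whether the cycle is modified by syndrome-state randomization -/
  randomized : Bool

namespace Cycle

variable {k s : ℕ} (c : Cycle k s)

/-- The distribution of the bitstring `s_r` that is added to the syndrome register before the
cycle: uniform with syndrome-state randomization, and `s_r = 0` without. -/
noncomputable def shiftProb (r : Bits s) : ℝ :=
  if c.randomized = true then 1 / 2 ^ s else if r = 0 then 1 else 0

/-- The operation conditioned on the content `θ` of the outcome register. With
`s_err = D θ + s_*`, it resets `S` by `X ^ s_err` and applies the logical recovery for `s_err`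
(for `s_err + s_r` under syndrome-state randomization). -/
noncomputable def feedback (r : Bits s) (θ : Bits c.o) :
    Matrix (Bits k × Bits s × Bits c.a × Bits c.o) (Bits k × Bits s × Bits c.a × Bits c.o) ℂ :=
  (c.cor (c.D θ + c.sStar + r)).mat ⊗ₖ
    ((xPauli (c.D θ + c.sStar)).mat ⊗ₖ
      ((1 : Matrix (Bits c.a) (Bits c.a) ℂ) ⊗ₖ proj θ))

/-- The noisy QEC cycle as a map on the states of `L` and `S`. -/
noncomputable def channel : Module.End ℂ (Matrix (Bits k × Bits s) (Bits k × Bits s) ℂ) :=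
  ∑ r : Bits s, (c.shiftProb r : ℂ) • ∑ θ : Bits c.o,
    discard ∘ₗ conjBy (c.feedback r θ) ∘ₗ mixture pauli4 c.noise ∘ₗ
      conjBy ((1 : Matrix (Bits k) (Bits k) ℂ) ⊗ₖ c.C) ∘ₗ adjoin c.a₀ ∘ₗ
      conjBy ((1 : Matrix (Bits k) (Bits k) ℂ) ⊗ₖ (xPauli r).mat)

/-- The inferred error syndrome `s_err` if the true syndrome is `sIn`, the randomizing bitstring
is `r` and the Pauli error is `P`. -/
def errSyndrome (sIn r : Bits s) (P : Pauli k × Pauli s × Pauli c.a × Pauli c.o) : Bits s :=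
  c.D (c.E (sIn + r) + P.2.2.2.flip) + c.sStar

/-- The syndrome after the cycle. -/
def outSyndrome (sIn r : Bits s) (P : Pauli k × Pauli s × Pauli c.a × Pauli c.o) : Bits s :=
  sIn + r + P.2.1.flip + c.errSyndrome sIn r P

/-- The transition probabilities `γ_{s_out, s_in}` of the syndrome. -/
noncomputable def γ (sOut sIn : Bits s) : ℝ :=
  ∑ r, ∑ P, if c.outSyndrome sIn r P = sOut then c.shiftProb r * c.noise P else 0

/-- The logical Pauli channel `Λ_{s_out, s_in}` conditioned on `s_in` and `s_out`;
it is `0` if `γ_{s_out, s_in} = 0`. -/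
noncomputable def Λ (sOut sIn : Bits s) : Superop k :=
  ((c.γ sOut sIn)⁻¹ : ℂ) • ∑ r, ∑ P,
    ((if c.outSyndrome sIn r P = sOut then c.shiftProb r * c.noise P else 0 : ℝ) : ℂ) •
      (conjBy (c.cor (c.errSyndrome sIn r P + r)).mat ∘ₗ conjBy P.1.mat)

/-- Syndrome marginal independence: `γ_{s_out, s_in}` does not depend on `s_in`. -/
def SyndromeMarginalIndependence : Prop :=
  ∀ sOut sIn sIn' : Bits s, c.γ sOut sIn = c.γ sOut sIn'

/-- The syndrome marginal distribution (meaningful under syndrome marginal independence, where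
the choice of the input syndrome is immaterial). -/
noncomputable def marginal (t : Bits s) : ℝ := c.γ t c.sStar

/-- The operator that corrects the logical error associated with the true syndrome `t`,
that is, with the error syndrome `t + s_*`. -/
noncomputable def corMat (t : Bits s) : Matrix (Bits k) (Bits k) ℂ :=
  (c.cor (t + c.sStar)).mat

/-- The channel `Cor_{s_out} ∘ Λ_{s_out, s_in} ∘ Cor_{s_in}†`. -/
noncomputable def Λtilde (sOut sIn : Bits s) : Superop k :=
  conjBy (c.corMat sOut) ∘ₗ c.Λ sOut sIn ∘ₗ conjBy (c.corMat sIn)ᴴ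

/-- The single-cycle logical error channel. -/
noncomputable def Λ₁ : Superop k :=
  ∑ sOut, ∑ sIn, ((c.marginal sOut * c.marginal sIn : ℝ) : ℂ) • c.Λtilde sOut sIn

/-- The single-cycle logical entanglement fidelity `f₁ = D⁻³ ∑_P tr (P Λ₁(P))`, `D = 2 ^ k`. -/
noncomputable def f₁ : ℝ :=
  (1 / ((2 : ℝ) ^ k) ^ 3) * (∑ P : Pauli k, (P.mat * c.Λ₁ P.mat).trace).re

end Cycle

/-! ### State preparations and measurements with Pauli-stochastic noise -/

/-- A state preparation with Pauli-stochastic noise. -/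
structure Preparation (k s : ℕ) where
  /-- the target logical state -/
  σ : Matrix (Bits k) (Bits k) ℂ
  posSemidef : σ.PosSemidef
  trace_eq_one : σ.trace = 1
  /-- mixture probabilities of the Pauli channel on `L` and `S` that acts on the encoded state -/
  noise : Pauli k × Pauli s → ℝ
  noise_mem : noise ∈ stdSimplex ℝ (Pauli k × Pauli s)

namespace Preparation

variable {k s : ℕ} (p : Preparation k s)

/-- The noisy initial state of `L` and `S` if the default syndrome is `sStar`. -/
noncomputable def state (sStar : Bits s) : Matrix (Bits k × Bits s) (Bits k × Bits s) ℂ :=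
  mixture pauli2 p.noise (p.σ ⊗ₖ proj sStar)

/-- The distribution of the syndrome after the preparation. -/
noncomputable def γ (sStar t : Bits s) : ℝ :=
  ∑ P, if sStar + P.2.flip = t then p.noise P else 0

/-- The logical Pauli channel of the preparation conditioned on the syndrome `t`;
it is `0` if `t` has probability zero. -/
noncomputable def Λ (sStar t : Bits s) : Superop k :=
  ((p.γ sStar t)⁻¹ : ℂ) • ∑ P,
    ((if sStar + P.2.flip = t then p.noise P else 0 : ℝ) : ℂ) • conjBy P.1.mat

end Preparation

/-- A destructive logical measurement with Pauli-stochastic noise. It is a computational-basis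
measurement of `L`, possibly preceded by a logical Clifford unitary `V` absorbed into `C`. -/
structure Measurement (k s : ℕ) where
  /-- number of ancilla qubits -/
  a : ℕ
  /-- number of outcome qubits -/
  o : ℕ
  /-- initial state of the ancillas -/
  a₀ : Bits a
  /-- the logical Clifford unitary that selects the measurement basis -/
  V : Matrix (Bits k) (Bits k) ℂ
  V_clifford : IsClifford (Pauli.mat (n := k)) V
  /-- the Clifford unitary on `L`, `S`, `A`, `O` that writes the measurement data to `O` -/
  C : Matrix (Bits k × Bits s × Bits a × Bits o) (Bits k × Bits s × Bits a × Bits o) ℂ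
  clifford : IsClifford (pauli4 (k := k) (s := s) (a := a) (o := o)) C
  /-- encoding of the outcomes -/
  E : Bits k → Bits s → Bits o
  /-- output state of the ancillas -/
  b : Bits k → Bits s → Bits a
  /-- `C (V† |x⟩ ⊗ |t⟩ ⊗ |a₀⟩ ⊗ |0⟩) = |x⟩ ⊗ |t⟩ ⊗ |b⟩ ⊗ |E(x, t)⟩` -/
  readout : ∀ (x : Bits k) (t : Bits s),
    (C * (Vᴴ ⊗ₖ (1 : Matrix (Bits s × Bits a × Bits o) (Bits s × Bits a × Bits o) ℂ))) *ᵥ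
        Pi.single (x, t, a₀, (0 : Bits o)) 1
      = Pi.single (x, t, b x t, E x t) 1
  /-- extraction of the outcome from the data in `O` -/
  D : Bits o → Bits k
  /-- mixture probabilities of the Pauli channel that acts directly after `C` -/
  noise : Pauli k × Pauli s × Pauli a × Pauli o → ℝ
  noise_mem : noise ∈ stdSimplex ℝ (Pauli k × Pauli s × Pauli a × Pauli o)

namespace Measurement

variable {k s : ℕ} (m : Measurement k s)

/-- The target logical POVM, `M_x = V† |x⟩⟨x| V`. -/
def povm (x : Bits k) : Matrix (Bits k) (Bits k) ℂ := m.Vᴴ * proj x * m.V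

/-- The probability that the noisy measurement of a state `ρ` of `L` and `S` has outcome `x`. -/
noncomputable def prob (ρ : Matrix (Bits k × Bits s) (Bits k × Bits s) ℂ) (x : Bits k) : ℝ :=
  ∑ θ : Bits m.o, if m.D θ = x then
    (((1 : Matrix (Bits k) (Bits k) ℂ) ⊗ₖ
        ((1 : Matrix (Bits s) (Bits s) ℂ) ⊗ₖ ((1 : Matrix (Bits m.a) (Bits m.a) ℂ) ⊗ₖ proj θ))) *
      mixture pauli4 m.noise (conjBy m.C (adjoin m.a₀ ρ))).trace.re
  else 0

/-- The probability of the outcome `x` for the logical basis state `V† |y⟩` and the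
syndrome `t`. -/
noncomputable def kernel (t : Bits s) (x y : Bits k) : ℝ :=
  ∑ P, if m.D (m.E y t + P.2.2.2.flip) = x then m.noise P else 0

/-- The logical channel of the measurement for the syndrome `t`: dephasing in the measurement
basis followed by the classical noise on the outcome. It satisfies
`Prob(x) = tr (M_x Λ_t(ρ))` on the state `ρ ⊗ |t⟩⟨t|`, and it is a Pauli channel whenever the
distribution of the difference of actual and ideal outcome does not depend on the latter. -/
noncomputable def Λ (t : Bits s) : Superop k :=
  ∑ x, ∑ y, (m.kernel t x y : ℂ) • conjBy (m.Vᴴ * Matrix.single x y 1 * m.V)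

end Measurement

/-! ### QEC experiments and logical Markovian models -/

/-- The sum over `s_0, …, s_{K-1}`, for fixed `s_K`, of the terms
`γ_{s_K,s_{K-1}} ⋯ γ_{s_1,s_0} γ^prep_{s_0} • Λ_{s_K,s_{K-1}} ∘ ⋯ ∘ Λ_{s_1,s_0} ∘ Λ^prep_{s_0}`. -/
noncomputable def pathSum {k s : ℕ} (c : Cycle k s) (p : Preparation k s) :
    ℕ → Bits s → Superop k
  | 0, t => (p.γ c.sStar t : ℂ) • p.Λ c.sStar t
  | K + 1, t => ∑ t', (c.γ t t' : ℂ) • (c.Λ t t' ∘ₗ pathSum c p K t')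

/-- The total logical error channel of the experiment with `K` cycles:
the sum over `s_0, …, s_K` of
`γ_{s_K,s_{K-1}} ⋯ γ_{s_1,s_0} γ^prep_{s_0} •
  Λ^meas_{s_K} ∘ Λ_{s_K,s_{K-1}} ∘ ⋯ ∘ Λ_{s_1,s_0} ∘ Λ^prep_{s_0}`. -/
noncomputable def Λtot {k s : ℕ} (c : Cycle k s) (p : Preparation k s) (m : Measurement k s)
    (K : ℕ) : Superop k :=
  ∑ t, m.Λ t ∘ₗ pathSum c p K t

/-- The probability of the outcome `x` in the experiment that consists of the preparation,
`K` repetitions of the cycle and the measurement. -/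
noncomputable def experimentProb {k s : ℕ} (c : Cycle k s) (p : Preparation k s)
    (m : Measurement k s) (K : ℕ) (x : Bits k) : ℝ :=
  m.prob ((c.channel ^ K) (p.state c.sStar)) x

/-- A logical Markovian model: superoperators on `L` for the preparations, for the QEC cycle
(independent of the setting) and for the measurements. -/
structure MarkovModel (k s : ℕ) where
  prep : Preparation k s → Superop k
  qec : Superop k
  meas : Measurement k s → Superop k

/-- The prediction `tr (M_x Φ_meas Φ_QEC ^ K Φ_prep (σ))` of the model. -/
noncomputable def MarkovModel.prediction {k s : ℕ} (M : MarkovModel k s) (p : Preparation k s)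
    (m : Measurement k s) (K : ℕ) (x : Bits k) : ℂ :=
  (m.povm x * M.meas m ((M.qec ^ K) (M.prep p p.σ))).trace

/-- `M` is a `(G, ε)`-approximate logical Markovian model for the set `Exp` of experimental
settings. -/
def MarkovModel.IsApprox {k s : ℕ} (M : MarkovModel k s) (c : Cycle k s)
    (Exp : Set (Preparation k s × Measurement k s)) (G ε : ℝ) : Prop :=
  0 < G ∧ 0 < ε ∧ ε < 1 ∧
    ∀ e ∈ Exp, ∀ K : ℕ, 0 < K → ∀ x : Bits k,
      ‖(e.2.povm x * Λtot c e.1 e.2 K e.1.σ).trace - M.prediction e.1 e.2 K x‖ ≤ G * ε ^ K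

end QEC

/-!
The logical channels of the preparations and of the cycle are diagonal in the Pauli basis. For each
Pauli operator `Q`, the sum over syndrome paths becomes the `K`-th power of a transfer operator
`T_Q` on `ℝ ^ syndromes`, symmetrized by the square roots of the syndrome probabilities `γ`. Without
logical errors, `T_Q` is the orthogonal projection onto a unit vector. A nontrivial `±1`-valued
character averages to `0`, so an eigenvalue of `Λ₁` deviates from `1` by at most twice the
infidelity, and the Hilbert–Schmidt distance of `T_Q` from that projection is at most `2 √ε₁`.

If `T` is at distance `δ ≤ √2 - 1` from the projection onto `ℝ v`, then an eigenvalue `μ` near `1`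
is found by applying the intermediate value theorem to `⟪v, R(μ) v⟫ = 1`, where `R(μ)` is the
resolvent of the difference, and `T` contracts by `(1 + √2) δ` on the orthogonal complement of the
left eigenvector. Hence `T ^ K = μ ^ K r ⊗ l` up to an error of order `((1 + √2) δ) ^ K`, and the
numbers `μ` and vectors `r`, `l` for all `Q` define the model. Summing the errors over syndromes and
Pauli operators with the Cauchy–Schwarz inequality costs the factor `√D`, because `tr σ² ≤ 1`.
-/

namespace QEC

/-! ### Powers of a perturbed rank-one projection -/

section RankOnePerturbation

open InnerProductSpace ContinuousLinearMap

lemma pow_apply_of_apply_eq_smul {R M : Type*} [Semiring R] [AddCommMonoid M] [Module R M]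
    [TopologicalSpace M] {T : M →L[R] M} {r : M} {μ : R} (hr : T r = μ • r) (K : ℕ) :
    (T ^ K) r = μ ^ K • r := by
  induction K with
  | zero => simp
  | succ K ih => rw [pow_succ', mul_apply_eq_comp, ih, map_smul, hr, smul_smul, pow_succ]

lemma smul_resolvent_apply {R M : Type*} [CommRing R] [AddCommGroup M] [Module R M]
    [TopologicalSpace M] [IsTopologicalAddGroup M] [ContinuousConstSMul R M] {E : M →L[R] M} {μ : R}
    (hμ : μ ∈ resolventSet R E) (v : M) :
    μ • resolvent E μ v = v + E (resolvent E μ v) := by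
  have h : (algebraMap R (M →L[R] M) μ - E) (resolvent E μ v) = v :=
    congrArg (· v) (Ring.mul_inverse_cancel _ hμ)
  rwa [sub_apply, ContinuousLinearMap.algebraMap_apply, sub_eq_iff_eq_add] at h

variable {H : Type*} [NormedAddCommGroup H] [InnerProductSpace ℝ H]

lemma sq_sub_sq_mul_norm_sq_le {v w e : H} {μ δ : ℝ} (hv : ‖v‖ = 1) (hw : μ • w = v + e)
    (he : ‖e‖ ≤ δ * ‖w‖) : (μ ^ 2 - δ ^ 2) * ‖w‖ ^ 2 ≤ 2 * μ * inner ℝ v w - 1 := by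
  have hnorm : ‖e‖ ^ 2 = μ ^ 2 * ‖w‖ ^ 2 - 2 * μ * inner ℝ v w + 1 := by
    rw [show e = μ • w - v by rw [hw]; abel, norm_sub_sq_real, norm_smul, mul_pow, hv,
      Real.norm_eq_abs, sq_abs, real_inner_smul_left, real_inner_comm]
    ring
  have hsq : ‖e‖ ^ 2 ≤ (δ * ‖w‖) ^ 2 := pow_le_pow_left₀ (norm_nonneg e) he 2
  linarith

lemma add_mul_inner_and_sub_mul_inner {v w e : H} {μ δ : ℝ} (hv : ‖v‖ = 1)
    (hw : μ • w = v + e) (he : ‖e‖ ≤ δ * ‖w‖) (hδ : 0 ≤ δ) (hμ : δ < μ) :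
    1 ≤ (μ + δ) * inner ℝ v w ∧ (μ - δ) * inner ℝ v w ≤ 1 := by
  have hquad := sq_sub_sq_mul_norm_sq_le hv hw he
  have hμδ : 0 < μ ^ 2 - δ ^ 2 := by nlinarith
  have hinner : inner ℝ v w ^ 2 ≤ ‖w‖ ^ 2 := by
    simpa [hv] using sq_le_sq' (by simpa [hv] using neg_le_of_abs_le (abs_real_inner_le_norm v w))
      (real_inner_le_norm v w)
  have hpos : 0 < inner ℝ v w := by
    have : 0 ≤ (μ ^ 2 - δ ^ 2) * ‖w‖ ^ 2 := by positivity
    by_contra! hneg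
    nlinarith
  have hprod : ((μ - δ) * inner ℝ v w - 1) * ((μ + δ) * inner ℝ v w - 1) ≤ 0 := by
    nlinarith [mul_le_mul_of_nonneg_left hinner hμδ.le]
  have horder : (μ - δ) * inner ℝ v w ≤ (μ + δ) * inner ℝ v w := by gcongr; linarith
  constructor <;> by_contra! h <;> nlinarith

lemma norm_sq_le_four_thirds {v w e : H} {μ δ : ℝ} (hv : ‖v‖ = 1) (hw : μ • w = v + e)
    (he : ‖e‖ ≤ δ * ‖w‖) (hvw : inner ℝ v w = 1) (hδ : δ ^ 2 ≤ 3 / 16) (hμ : δ ^ 2 < μ ^ 2) :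
    ‖w‖ ^ 2 ≤ 4 / 3 := by
  have hquad := sq_sub_sq_mul_norm_sq_le hv hw he
  rw [hvw] at hquad
  have hmin : 2 * μ * 1 - 1 ≤ (μ ^ 2 - δ ^ 2) * (4 / 3) := by nlinarith [sq_nonneg (μ - 3 / 4)]
  exact le_of_mul_le_mul_left (hquad.trans hmin) (sub_pos.2 hμ)

lemma inner_sq_add_inner_sq_le {l x : H} (r : H) (hlx : inner ℝ l x = 0) :
    inner ℝ l r ^ 2 * ‖x‖ ^ 2 + inner ℝ x r ^ 2 * ‖l‖ ^ 2 ≤ ‖l‖ ^ 2 * ‖x‖ ^ 2 * ‖r‖ ^ 2 := by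
  set S := inner ℝ l r ^ 2 * ‖x‖ ^ 2 + inner ℝ x r ^ 2 * ‖l‖ ^ 2
  rcases (by positivity : 0 ≤ S).eq_or_lt with h0 | hpos
  · rw [← h0]; positivity
  set u := (inner ℝ l r * ‖x‖ ^ 2) • l + (inner ℝ x r * ‖l‖ ^ 2) • x with hu
  have hur : inner ℝ u r = S := by
    rw [hu, inner_add_left, real_inner_smul_left, real_inner_smul_left]; ring
  have huu : ‖u‖ ^ 2 = S * (‖l‖ ^ 2 * ‖x‖ ^ 2) := by
    rw [hu, norm_add_sq_real, norm_smul, norm_smul, real_inner_smul_left, real_inner_smul_right,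
      hlx]
    simp only [mul_pow, Real.norm_eq_abs, sq_abs]
    ring
  have hcs : S ^ 2 ≤ ‖u‖ ^ 2 * ‖r‖ ^ 2 := by
    rw [← hur, ← sq_abs, ← mul_pow]
    exact pow_le_pow_left₀ (abs_nonneg _) (abs_real_inner_le_norm u r) 2
  rw [huu] at hcs
  exact le_of_mul_le_mul_left (by linarith) hpos

/-- The projection along `r` onto the orthogonal complement of `l` has the same norm as the
complementary projection onto `r`, which is the rank-one operator `y ↦ (⟪l, y⟫ / ⟪l, r⟫) r`. -/
lemma inner_mul_norm_le_of_inner_eq_zero {l x : H} (r : H) (a : ℝ) (hlx : inner ℝ l x = 0) :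
    inner ℝ l r * ‖x‖ ≤ ‖l‖ * ‖r‖ * ‖x + a • r‖ := by
  rcases eq_or_ne x 0 with rfl | hx
  · simp only [norm_zero, mul_zero]; positivity
  -- `z` is orthogonal to `r`, so its inner product with `x + a • r` does not depend on `a`.
  set z := inner ℝ l r • x - inner ℝ x r • l with hz
  have hz_inner : inner ℝ z (x + a • r) = inner ℝ l r * ‖x‖ ^ 2 := by
    rw [hz, inner_add_right, inner_sub_left, inner_sub_left]
    simp only [real_inner_smul_left, real_inner_smul_right, hlx, real_inner_self_eq_norm_sq]
    ring
  have hz_sq : ‖z‖ ^ 2 = inner ℝ l r ^ 2 * ‖x‖ ^ 2 + inner ℝ x r ^ 2 * ‖l‖ ^ 2 := by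
    rw [hz, norm_sub_sq_real, norm_smul, norm_smul, real_inner_smul_left, real_inner_smul_right,
      real_inner_comm l x, hlx]
    simp only [mul_pow, Real.norm_eq_abs, sq_abs]
    ring
  have hz_norm : ‖z‖ ≤ ‖l‖ * ‖x‖ * ‖r‖ := by
    refine le_of_sq_le_sq ?_ (by positivity)
    rw [hz_sq, mul_pow, mul_pow]
    exact inner_sq_add_inner_sq_le r hlx
  have hx' : 0 < ‖x‖ := norm_pos_iff.2 hx
  refine le_of_mul_le_mul_right ?_ hx'
  calc inner ℝ l r * ‖x‖ * ‖x‖ = inner ℝ z (x + a • r) := by rw [hz_inner]; ring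
    _ ≤ ‖z‖ * ‖x + a • r‖ := real_inner_le_norm _ _
    _ ≤ ‖l‖ * ‖x‖ * ‖r‖ * ‖x + a • r‖ := by gcongr
    _ = ‖l‖ * ‖r‖ * ‖x + a • r‖ * ‖x‖ := by ring

lemma two_thirds_le_inner {v l r : H} (hv : ‖v‖ = 1) (hvl : inner ℝ v l = 1)
    (hvr : inner ℝ v r = 1) (hl : ‖l‖ ^ 2 ≤ 4 / 3) (hr : ‖r‖ ^ 2 ≤ 4 / 3) :
    2 / 3 ≤ inner ℝ l r := by
  have hlv : inner ℝ l v = 1 := by rw [real_inner_comm, hvl]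
  have hnorm : ‖(l - v) + (r - v)‖ ^ 2 = ‖l‖ ^ 2 + ‖r‖ ^ 2 + 2 * inner ℝ l r - 4 := by
    have hv' : inner ℝ v v = 1 := by rw [real_inner_self_eq_norm_sq, hv, one_pow]
    have hrv : inner ℝ r v = 1 := by rw [real_inner_comm, hvr]
    simp only [← real_inner_self_eq_norm_sq, inner_add_left, inner_add_right, inner_sub_left,
      inner_sub_right, hv', hvl, hvr, hlv, hrv, real_inner_comm l r]
    ring
  nlinarith [sq_nonneg ‖(l - v) + (r - v)‖]

variable [CompleteSpace H]

lemma smul_adjoint_resolvent_apply {E : H →L[ℝ] H} {μ : ℝ} (hμ : μ ∈ resolventSet ℝ E) (v : H) :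
    μ • adjoint (resolvent E μ) v = v + adjoint E (adjoint (resolvent E μ) v) := by
  refine ext_inner_right ℝ fun x => ?_
  have h : resolvent E μ ((algebraMap ℝ (H →L[ℝ] H) μ - E) x) = x :=
    congrArg (· x) (Ring.inverse_mul_cancel _ hμ)
  rw [inner_add_left, adjoint_inner_left, ← sub_eq_iff_eq_add, real_inner_smul_left,
    ← real_inner_smul_right, ← inner_sub_right, adjoint_inner_left]
  simpa [ContinuousLinearMap.algebraMap_apply] using congrArg (inner ℝ v) h

lemma mem_resolventSet_of_norm_lt {E : H →L[ℝ] H} {μ : ℝ} (hμ : ‖E‖ < μ) :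
    μ ∈ resolventSet ℝ E :=
  spectrum.mem_resolventSet_of_norm_lt_mul <|
    (mul_le_of_le_one_right (norm_nonneg E) norm_id_le).trans_lt (hμ.trans_le (le_abs_self μ))

lemma exists_inner_resolvent_eq_one {v : H} (hv : ‖v‖ = 1) {E : H →L[ℝ] H} (hE : ‖E‖ < 1 / 2) :
    ∃ μ : ℝ, ‖E‖ < μ ∧ inner ℝ v (resolvent E μ v) = 1 := by
  set δ := ‖E‖
  have hδ : 0 ≤ δ := norm_nonneg E
  have hbounds : ∀ μ : ℝ, δ < μ → 1 ≤ (μ + δ) * inner ℝ v (resolvent E μ v) ∧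
      (μ - δ) * inner ℝ v (resolvent E μ v) ≤ 1 := fun μ hμ =>
    add_mul_inner_and_sub_mul_inner hv (smul_resolvent_apply (mem_resolventSet_of_norm_lt hμ) v)
      (E.le_opNorm _) hδ hμ
  have hcont : ContinuousOn (fun μ : ℝ => inner ℝ v (resolvent E μ v)) (Set.Icc (1 - δ) (1 + δ)) :=
    fun μ hμ =>
      have := (spectrum.hasDerivAt_resolvent_const_left
        (mem_resolventSet_of_norm_lt (show δ < μ by linarith [hμ.1]))).continuousAt
      ContinuousAt.continuousWithinAt (by fun_prop)
  have hlow := (hbounds (1 - δ) (by linarith)).1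
  have hhigh := (hbounds (1 + δ) (by linarith)).2
  rw [sub_add_cancel, one_mul] at hlow
  rw [add_sub_cancel_right, one_mul] at hhigh
  obtain ⟨μ, hμ, h⟩ := intermediate_value_Icc' (by linarith) hcont ⟨hhigh, hlow⟩
  exact ⟨μ, by linarith [hμ.1], h⟩

lemma exists_leading_eigenvectors {v : H} (hv : ‖v‖ = 1) {T : H →L[ℝ] H} {δ : ℝ}
    (hT : ‖T - rankOne ℝ v v‖ ≤ δ) (hδ : δ ^ 2 ≤ 3 / 16) :
    ∃ (μ : ℝ) (r l : H), (T r = μ • r ∧ adjoint T l = μ • l) ∧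
      (inner ℝ v r = 1 ∧ inner ℝ v l = 1) ∧ ‖r‖ ^ 2 ≤ 4 / 3 ∧ ‖l‖ ^ 2 ≤ 4 / 3 := by
  obtain ⟨E, rfl⟩ : ∃ E, T = E + rankOne ℝ v v := ⟨T - rankOne ℝ v v, (sub_add_cancel _ _).symm⟩
  rw [add_sub_cancel_right] at hT
  have hE : ‖E‖ ^ 2 ≤ 3 / 16 := (pow_le_pow_left₀ (norm_nonneg E) hT 2).trans hδ
  obtain ⟨μ, hμ, hvr⟩ := exists_inner_resolvent_eq_one hv (E := E) (by nlinarith [norm_nonneg E])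
  have hmem := mem_resolventSet_of_norm_lt hμ
  have hvl : inner ℝ v (adjoint (resolvent E μ) v) = 1 := by
    rw [adjoint_inner_right, real_inner_comm, hvr]
  have hμ2 : ‖E‖ ^ 2 < μ ^ 2 := pow_lt_pow_left₀ hμ (norm_nonneg E) two_ne_zero
  refine ⟨μ, resolvent E μ v, adjoint (resolvent E μ) v, ⟨?_, ?_⟩, ⟨hvr, hvl⟩,
    norm_sq_le_four_thirds hv (smul_resolvent_apply hmem v) (E.le_opNorm _) hvr hE hμ2,
    norm_sq_le_four_thirds hv (smul_adjoint_resolvent_apply hmem v) ?_ hvl hE hμ2⟩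
  · rw [smul_resolvent_apply hmem, add_apply, rankOne_apply, hvr, one_smul, add_comm]
  · rw [smul_adjoint_resolvent_apply hmem, map_add, add_apply, adjoint_rankOne, rankOne_apply,
      hvl, one_smul, add_comm]
  · rw [← (adjoint : (H →L[ℝ] H) ≃ₗᵢ⋆[ℝ] _).norm_map E]
    exact (adjoint E).le_opNorm _

lemma inner_apply_eq_zero_of_adjoint_apply {T : H →L[ℝ] H} {l x : H} {μ : ℝ}
    (hl : adjoint T l = μ • l) (hlx : inner ℝ l x = 0) : inner ℝ l (T x) = 0 := by
  rw [← adjoint_inner_left, hl, real_inner_smul_left, hlx, mul_zero]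

lemma norm_apply_le_of_inner_eq_zero {v : H} (hv : ‖v‖ = 1) {T : H →L[ℝ] H} {l x : H} {μ : ℝ}
    (hl : adjoint T l = μ • l) (hvl : inner ℝ v l = 1) (hlx : inner ℝ l x = 0) :
    ‖T x‖ ≤ (1 + ‖l‖) * ‖T - rankOne ℝ v v‖ * ‖x‖ := by
  set E := T - rankOne ℝ v v with hE
  have hTx : T x = E x + inner ℝ v x • v := by
    rw [hE, sub_apply, rankOne_apply, sub_add_cancel]
  have hvx : inner ℝ v x = -inner ℝ l (E x) := by
    have h := inner_apply_eq_zero_of_adjoint_apply hl hlx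
    rw [hTx, inner_add_right, real_inner_smul_right, real_inner_comm v l, hvl] at h
    linarith
  calc ‖T x‖ ≤ ‖E x‖ + |inner ℝ l (E x)| := by
        refine hTx ▸ (norm_add_le _ _).trans_eq ?_
        rw [norm_smul, hv, mul_one, hvx, norm_neg, Real.norm_eq_abs]
    _ ≤ ‖E x‖ + ‖l‖ * ‖E x‖ := by gcongr; exact abs_real_inner_le_norm _ _
    _ = (1 + ‖l‖) * ‖E x‖ := by ring
    _ ≤ (1 + ‖l‖) * ‖E‖ * ‖x‖ := by
        rw [mul_assoc]; gcongr; exact E.le_opNorm x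

lemma norm_pow_apply_le_of_inner_eq_zero {T : H →L[ℝ] H} {l : H} {μ q : ℝ} (hq : 0 ≤ q)
    (hl : adjoint T l = μ • l) (hT : ∀ x, inner ℝ l x = 0 → ‖T x‖ ≤ q * ‖x‖) (K : ℕ) :
    ∀ x, inner ℝ l x = 0 → ‖(T ^ K) x‖ ≤ q ^ K * ‖x‖ := by
  induction K with
  | zero => simp
  | succ K ih =>
    intro x hlx
    calc ‖(T ^ (K + 1)) x‖ = ‖(T ^ K) (T x)‖ := by rw [pow_succ, mul_apply_eq_comp]
      _ ≤ q ^ K * ‖T x‖ := ih _ (inner_apply_eq_zero_of_adjoint_apply hl hlx)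
      _ ≤ q ^ K * (q * ‖x‖) := by gcongr; exact hT x hlx
      _ = q ^ (K + 1) * ‖x‖ := by ring

theorem exists_rankOne_approx_pow {v : H} (hv : ‖v‖ = 1) {T : H →L[ℝ] H} {δ : ℝ}
    (hT : ‖T - rankOne ℝ v v‖ ≤ δ) (hδ : (1 + √2) * δ ≤ 1) :
    ∃ (μ : ℝ) (r l : H), ∀ K : ℕ,
      ‖T ^ K - μ ^ K • rankOne ℝ r l‖ ≤ 2 * ((1 + √2) * δ) ^ K := by
  have hδ₀ : 0 ≤ δ := (norm_nonneg _).trans hT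
  have hδ₁ : δ ^ 2 ≤ 3 / 16 := by
    have := Real.sq_sqrt (show (0 : ℝ) ≤ 2 by norm_num)
    have := Real.sqrt_nonneg 2
    have : (1.4 : ℝ) ≤ √2 := Real.le_sqrt_of_sq_le (by norm_num)
    nlinarith
  obtain ⟨μ, r, l, ⟨hr, hl⟩, ⟨hvr, hvl⟩, hr_norm, hl_norm⟩ := exists_leading_eigenvectors hv hT hδ₁
  have hlr := two_thirds_le_inner hv hvl hvr hl_norm hr_norm
  have hcontract : ∀ x, inner ℝ l x = 0 → ‖T x‖ ≤ (1 + √2) * δ * ‖x‖ := fun x hlx => by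
    have : ‖l‖ ≤ √2 := Real.le_sqrt_of_sq_le (by linarith)
    exact (norm_apply_le_of_inner_eq_zero hv hl hvl hlx).trans (by gcongr)
  refine ⟨μ, r, (inner ℝ l r)⁻¹ • l, fun K => opNorm_le_bound _ (by positivity) fun y => ?_⟩
  set a := (inner ℝ l r)⁻¹ * inner ℝ l y with ha
  have hlx : inner ℝ l (y - a • r) = 0 := by
    rw [inner_sub_right, real_inner_smul_right, ha]
    field_simp
    ring
  have hremainder : (T ^ K - μ ^ K • rankOne ℝ r ((inner ℝ l r)⁻¹ • l)) y =
      (T ^ K) (y - a • r) := by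
    rw [sub_apply, smul_apply, rankOne_apply, real_inner_smul_left, map_sub, map_smul,
      pow_apply_of_apply_eq_smul hr, smul_comm]
  have hx_norm : ‖y - a • r‖ ≤ 2 * ‖y‖ := by
    have h := inner_mul_norm_le_of_inner_eq_zero r a hlx
    rw [sub_add_cancel] at h
    have hlr_norm : ‖l‖ * ‖r‖ ≤ 4 / 3 := by nlinarith [sq_nonneg (‖l‖ - ‖r‖)]
    nlinarith [norm_nonneg y, norm_nonneg (y - a • r)]
  calc _ = ‖(T ^ K) (y - a • r)‖ := by rw [hremainder]
    _ ≤ ((1 + √2) * δ) ^ K * ‖y - a • r‖ :=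
        norm_pow_apply_le_of_inner_eq_zero (by positivity) hl hcontract K _ hlx
    _ ≤ ((1 + √2) * δ) ^ K * (2 * ‖y‖) := by gcongr
    _ = 2 * ((1 + √2) * δ) ^ K * ‖y‖ := by ring

end RankOnePerturbation

/-! ### Real characters of a finite group -/

section RealCharacters

variable {G : Type*} [Group G]

lemma abs_character_apply [Finite G] (χ : G →* ℝ) (g : G) : |χ g| = 1 :=
  (χ.isOfFinOrder (isOfFinOrder_of_finite g)).norm_eq_one

variable [Fintype G]

lemma one_sub_character_le (χ : G →* ℝ) (g : G) :
    1 - χ g ≤ 2 * (1 - (Fintype.card G : ℝ)⁻¹ * ∑ h, χ h) := by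
  classical
  rcases eq_or_ne χ 1 with rfl | hχ
  · simp
  · rw [sum_hom_units_eq_zero χ hχ]
    linarith [neg_le_of_abs_le (abs_character_apply χ g).le]

lemma one_sub_sum_mul_character_le {ι : Type*} [Fintype ι] {w : ι → ℝ} (hw : ∀ i, 0 ≤ w i)
    (hsum : ∑ i, w i = 1) (χ : ι → G →* ℝ) (g : G) :
    1 - ∑ i, w i * χ i g ≤ 2 * (1 - (Fintype.card G : ℝ)⁻¹ * ∑ h, ∑ i, w i * χ i h) := by
  calc 1 - ∑ i, w i * χ i g = ∑ i, w i * (1 - χ i g) := by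
        simp only [mul_sub, mul_one, Finset.sum_sub_distrib, hsum]
    _ ≤ ∑ i, w i * (2 * (1 - (Fintype.card G : ℝ)⁻¹ * ∑ h, χ i h)) :=
        Finset.sum_le_sum fun i _ => mul_le_mul_of_nonneg_left (one_sub_character_le _ g) (hw i)
    _ = 2 * (∑ i, w i - (Fintype.card G : ℝ)⁻¹ * ∑ i, w i * ∑ h, χ i h) := by
        simp only [Finset.mul_sum, ← Finset.sum_sub_distrib]
        exact Finset.sum_congr rfl fun i _ => by simp only [mul_sub, Finset.mul_sum]; ring_nf
    _ = _ := by simp only [hsum, Finset.mul_sum, Finset.sum_comm (γ := G)]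

end RealCharacters

/-! ### Pauli operators -/

lemma conjBy_apply {m n : Type*} [Fintype m] [Fintype n] (K : Matrix m n ℂ) (ρ : Matrix n n ℂ) :
    conjBy K ρ = K * ρ * Kᴴ := rfl

lemma star_trace_mul_of_isHermitian {n R : Type*} [Fintype n] [CommRing R] [StarRing R]
    {A B : Matrix n n R} (hA : A.IsHermitian) (hB : B.IsHermitian) :
    star (A * B).trace = (A * B).trace := by
  rw [← Matrix.trace_conjTranspose, Matrix.conjTranspose_mul, hA.eq, hB.eq, Matrix.trace_mul_comm]

lemma forall_bit {p : ZMod 2 → Prop} : (∀ a, p a) ↔ p 0 ∧ p 1 := Fin.forall_fin_two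

lemma sum_bit {M : Type*} [AddCommMonoid M] (f : ZMod 2 → M) : ∑ a, f a = f 0 + f 1 :=
  Fin.sum_univ_two f

namespace Pauli1

/-- The group of single-qubit Pauli operators modulo phases. -/
instance : CommGroup Pauli1 where
  one := .I
  mul
    | .I, Q => Q
    | P, .I => P
    | .X, .X | .Y, .Y | .Z, .Z => .I
    | .X, .Y | .Y, .X => .Z
    | .Y, .Z | .Z, .Y => .X
    | .X, .Z | .Z, .X => .Y
  inv P := P
  mul_assoc := by decide
  one_mul := by decide
  mul_one := by decide
  inv_mul_cancel := by decide
  mul_comm := by decide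

/-- The sign in `A Q A = ± Q`, as a character of the Pauli operator `Q` modulo phases. -/
def sgn (A : Pauli1) : Pauli1 →* ℤ where
  toFun Q := if A = .I ∨ Q = .I ∨ A = Q then 1 else -1
  map_one' := by revert A; decide
  map_mul' := by revert A; decide

lemma mat_apply_mul_star (A : Pauli1) (a b t : ZMod 2) :
    A.mat a t * star (A.mat b t) = if a = t + A.flip ∧ b = t + A.flip then 1 else 0 := by
  have h2 : (1 : ZMod 2) + 1 = 0 := by decide
  revert a b t
  rcases A with _ | _ | _ | _ <;> simp [forall_bit, mat, flip, h2]

lemma conjTranspose_mat (A : Pauli1) : A.matᴴ = A.mat := by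
  have h2 : (1 : ZMod 2) + 1 = 0 := by decide
  rw [← Matrix.ext_iff]
  rcases A with _ | _ | _ | _ <;> simp [forall_bit, mat, Matrix.conjTranspose_apply, h2]

lemma mat_mul_mat_mul_mat (A Q : Pauli1) :
    A.mat * Q.mat * A.mat = (sgn A Q : ℂ) • Q.mat := by
  have h2 : (1 : ZMod 2) + 1 = 0 := by decide
  rw [← Matrix.ext_iff]
  rcases A with _ | _ | _ | _ <;> rcases Q with _ | _ | _ | _ <;>
    simp [forall_bit, mat, sgn, Matrix.mul_apply, sum_bit, h2]

lemma sum_mat_mul_mat (a b c d : ZMod 2) :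
    ∑ A : Pauli1, A.mat a b * A.mat c d = if a = d ∧ b = c then 2 else 0 := by
  have h2 : (1 : ZMod 2) + 1 = 0 := by decide
  have hsum : ∀ f : Pauli1 → ℂ, ∑ A, f A = f .I + (f .X + (f .Y + f .Z)) := fun f => by
    simp [Finset.univ, Fintype.elems]
  rw [hsum]
  revert a b c d
  simp [forall_bit, mat, h2]
  norm_num

end Pauli1

section TensorProd

variable {ι κ R : Type*} [Fintype ι] [CommSemiring R]

/-- The tensor product of a family of square matrices, with rows and columns indexed by
functions. -/
def tensorProd (A : ι → Matrix κ κ R) : Matrix (ι → κ) (ι → κ) R :=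
  Matrix.of fun x y => ∏ j, A j (x j) (y j)

lemma tensorProd_mul [DecidableEq ι] [Fintype κ] (A B : ι → Matrix κ κ R) :
    tensorProd A * tensorProd B = tensorProd fun j => A j * B j := by
  ext x y
  simp only [tensorProd, Matrix.mul_apply, Matrix.of_apply, ← Finset.prod_mul_distrib,
    Finset.prod_univ_sum, Fintype.piFinset_univ]

lemma tensorProd_smul (z : ι → R) (A : ι → Matrix κ κ R) :
    (tensorProd fun j => z j • A j) = (∏ j, z j) • tensorProd A := by
  ext x y
  simp [tensorProd, Finset.prod_mul_distrib]

lemma conjTranspose_tensorProd [StarRing R] (A : ι → Matrix κ κ R) :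
    (tensorProd A)ᴴ = tensorProd fun j => (A j)ᴴ := by
  ext x y
  simp [tensorProd, Matrix.conjTranspose_apply]

end TensorProd

namespace Pauli

variable {n : ℕ}

lemma mat_eq_tensorProd (P : Pauli n) : P.mat = tensorProd fun j => (P j).mat := rfl

lemma mat_one : (1 : Pauli n).mat = 1 := by
  ext x y
  change ∏ j, (1 : Matrix (ZMod 2) (ZMod 2) ℂ) (x j) (y j) = _
  simp [Matrix.one_apply, Fintype.prod_ite_zero, funext_iff]

/-- The sign in `A Q A = ± Q`, as a character of the Pauli operator `Q` modulo phases. -/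
noncomputable def sgn (A : Pauli n) : Pauli n →* ℝ :=
  ∏ j, ((Int.castRingHom ℝ : ℤ →* ℝ).comp (Pauli1.sgn (A j))).comp (Pi.evalMonoidHom _ j)

lemma sgn_apply (A Q : Pauli n) : sgn A Q = ∏ j, (Pauli1.sgn (A j) (Q j) : ℝ) := by
  simp [sgn, MonoidHom.finsetProd_apply]

lemma card_eq : Fintype.card (Pauli n) = 4 ^ n := by
  rw [Fintype.card_fun, Fintype.card_fin]; rfl

lemma conjTranspose_mat (P : Pauli n) : P.matᴴ = P.mat := by
  simp only [mat_eq_tensorProd, conjTranspose_tensorProd, Pauli1.conjTranspose_mat]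

lemma conjBy_mat (P Q : Pauli n) : conjBy P.mat Q.mat = (sgn P Q : ℂ) • Q.mat := by
  rw [conjBy_apply, conjTranspose_mat]
  simp only [mat_eq_tensorProd, tensorProd_mul, Pauli1.mat_mul_mat_mul_mat, tensorProd_smul,
    sgn_apply, Complex.ofReal_prod, Complex.ofReal_intCast]

lemma mat_mul_self (P : Pauli n) : P.mat * P.mat = 1 := by
  simpa [conjBy_apply, conjTranspose_mat, mat_one] using conjBy_mat P 1

lemma sum_mat_mul_mat (x y z w : Bits n) :
    ∑ P : Pauli n, P.mat x y * P.mat z w = if x = w ∧ y = z then 2 ^ n else 0 := by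
  simp only [mat, Matrix.of_apply, ← Finset.prod_mul_distrib]
  rw [← Fintype.piFinset_univ, Finset.sum_prod_piFinset Finset.univ
    fun j (A : Pauli1) => A.mat (x j) (y j) * A.mat (z j) (w j)]
  simp [Pauli1.sum_mat_mul_mat, Fintype.prod_ite_zero, funext_iff, forall_and]

lemma sum_trace_smul_mat (A : Matrix (Bits n) (Bits n) ℂ) :
    ∑ P : Pauli n, (P.mat * A).trace • P.mat = (2 : ℂ) ^ n • A := by
  ext x y
  calc (∑ P : Pauli n, (P.mat * A).trace • P.mat) x y
      = ∑ z, ∑ w, (∑ P : Pauli n, P.mat z w * P.mat x y) * A w z := by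
        simp only [Matrix.sum_apply, Matrix.smul_apply, smul_eq_mul, Matrix.trace,
          Matrix.diag_apply, Matrix.mul_apply, Finset.sum_mul]
        rw [Finset.sum_comm]
        refine Finset.sum_congr rfl fun z _ => ?_
        rw [Finset.sum_comm]
        exact Finset.sum_congr rfl fun w _ => Finset.sum_congr rfl fun P _ => by ring
    _ = 2 ^ n * A x y := by simp [sum_mat_mul_mat, ite_and]

lemma eq_sum_trace_smul_mat (A : Matrix (Bits n) (Bits n) ℂ) :
    A = ((2 : ℂ) ^ n)⁻¹ • ∑ P : Pauli n, (P.mat * A).trace • P.mat := by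
  rw [sum_trace_smul_mat, smul_smul, inv_mul_cancel₀ (by positivity), one_smul]

/-- The basis of the operators on `n` qubits that consists of the Pauli operators. -/
noncomputable def basis : Module.Basis (Pauli n) ℂ (Matrix (Bits n) (Bits n) ℂ) :=
  basisOfTopLeSpanOfCardEqFinrank Pauli.mat
    (fun A _ => by
      rw [eq_sum_trace_smul_mat A]
      exact Submodule.smul_mem _ _ (Submodule.sum_mem _ fun P _ =>
        Submodule.smul_mem _ _ (Submodule.subset_span (Set.mem_range_self P))))
    (by rw [card_eq]; simp [Module.finrank_matrix, ← mul_pow])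

lemma basis_apply (P : Pauli n) : basis P = P.mat := by
  simp [basis]

/-- The algebra of superoperators that are diagonal in the Pauli basis with real eigenvalues,
parametrized by the eigenvalues. -/
noncomputable def diagonal : (Pauli n → ℝ) →ₐ[ℝ] Superop n :=
  (((Matrix.toLinAlgEquiv basis).toAlgHom.comp (Matrix.diagonalAlgHom ℂ)).restrictScalars ℝ).comp
    (Complex.ofRealAm.compLeft (Pauli n))

lemma diagonal_mat (h : Pauli n → ℝ) (Q : Pauli n) : diagonal h Q.mat = (h Q : ℂ) • Q.mat := by
  have hbasis := Matrix.toLinAlgEquiv_self basis (Matrix.diagonal fun P => (h P : ℂ)) Q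
  change Matrix.toLinAlgEquiv basis (Matrix.diagonal fun P => (h P : ℂ)) Q.mat = _
  simpa [Matrix.diagonal_apply, basis_apply, ite_smul] using hbasis

lemma conjBy_mat_eq_diagonal (P : Pauli n) : conjBy P.mat = diagonal (sgn P) :=
  basis.ext fun Q => by rw [basis_apply, conjBy_mat, diagonal_mat]

lemma trace_mul_diagonal (h : Pauli n → ℝ) (A B : Matrix (Bits n) (Bits n) ℂ) :
    (A * diagonal h B).trace =
      ((2 : ℂ) ^ n)⁻¹ * ∑ Q : Pauli n, h Q * ((Q.mat * A).trace * (Q.mat * B).trace) := by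
  conv_lhs => rw [eq_sum_trace_smul_mat B]
  simp only [map_smul, map_sum, diagonal_mat, Matrix.mul_smul, Matrix.mul_sum, Matrix.trace_smul,
    Matrix.trace_sum, smul_eq_mul, Matrix.trace_mul_comm A]
  congr 1
  exact Finset.sum_congr rfl fun Q _ => by ring

lemma sum_trace_mat_mul_mat_diagonal (h : Pauli n → ℝ) :
    ∑ P : Pauli n, (P.mat * diagonal h P.mat).trace = ((2 ^ n * ∑ P, h P : ℝ) : ℂ) := by
  simp [diagonal_mat, mat_mul_self, Matrix.trace_one, Finset.mul_sum, mul_comm]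

lemma sum_norm_sq_trace {A : Matrix (Bits n) (Bits n) ℂ} (hA : A.IsHermitian) :
    ((∑ P : Pauli n, ‖(P.mat * A).trace‖ ^ 2 : ℝ) : ℂ) = 2 ^ n * (A * A).trace := by
  have h := congrArg (fun B => (B * A).trace) (sum_trace_smul_mat A)
  simp only [Matrix.sum_mul, Matrix.trace_sum, Matrix.smul_mul, Matrix.trace_smul,
    smul_eq_mul] at h
  rw [← h]
  push_cast
  refine Finset.sum_congr rfl fun P _ => ?_
  rw [← Complex.mul_conj', starRingEnd_apply,
    star_trace_mul_of_isHermitian P.conjTranspose_mat hA]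

lemma conjBy_proj (P : Pauli n) (t : Bits n) : conjBy P.mat (proj t) = proj (t + P.flip) := by
  ext x y
  have h1 : (P.mat * proj t * P.matᴴ) x y = P.mat x t * star (P.mat y t) := by
    simp [proj, Matrix.mul_apply, Matrix.single_apply, ite_and]
  rw [conjBy_apply, h1]
  simp only [mat, Matrix.of_apply, star_prod, ← Finset.prod_mul_distrib,
    Pauli1.mat_apply_mul_star, Fintype.prod_ite_zero, Finset.prod_const_one]
  simp only [proj, Matrix.single_apply, forall_and, funext_iff, flip, Pi.add_apply, eq_comm]

lemma flip_xPauli (t : Bits n) : (xPauli t).flip = t := by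
  funext j
  have : ∀ a : ZMod 2, (if a = 0 then Pauli1.I else Pauli1.X).flip = a := by decide
  exact this (t j)

end Pauli

/-! ### Syndrome-resolved channels -/

section CenterMass

variable {ι : Type*} [Fintype ι] {w : ι → ℝ}

lemma sum_smul_centerMass {M : Type*} [AddCommGroup M] [Module ℝ M] (hw : ∀ i, 0 ≤ w i)
    (x : ι → M) : (∑ i, w i) • Finset.univ.centerMass w x = ∑ i, w i • x i := by
  by_cases h : ∑ i, w i = 0
  · have hw0 : ∀ i, w i = 0 := fun i =>
      (Finset.sum_eq_zero_iff_of_nonneg fun i _ => hw i).1 h i (Finset.mem_univ i)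
    simp [hw0]
  · rw [Finset.centerMass, smul_inv_smul₀ h]

lemma abs_centerMass_apply_le_one {κ : Type*} {x : ι → κ → ℝ} {q : κ} (hw : ∀ i, 0 ≤ w i)
    (hx : ∀ i, |x i q| ≤ 1) : |Finset.univ.centerMass w x q| ≤ 1 := by
  have hsum : 0 ≤ ∑ i, w i := Finset.sum_nonneg fun i _ => hw i
  have habs : |∑ i, w i * x i q| ≤ ∑ i, w i :=
    (Finset.abs_sum_le_sum_abs _ _).trans <| Finset.sum_le_sum fun i _ => by
      rw [abs_mul, abs_of_nonneg (hw i)]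
      exact mul_le_of_le_one_right (hw i) (hx i)
  simp only [Finset.centerMass, Pi.smul_apply, Finset.sum_apply, smul_eq_mul]
  rw [abs_mul, abs_of_nonneg (inv_nonneg.2 hsum)]
  exact (mul_le_mul_of_nonneg_left habs (inv_nonneg.2 hsum)).trans inv_mul_le_one

lemma map_centerMass {M N : Type*} [AddCommGroup M] [Module ℝ M] [AddCommGroup N] [Module ℝ N]
    (f : M →ₗ[ℝ] N) (x : ι → M) :
    f (Finset.univ.centerMass w x) = Finset.univ.centerMass w (f ∘ x) := by
  simp [Finset.centerMass, map_sum]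

end CenterMass

section FiberWeight

variable {ι τ : Type*} [DecidableEq τ]

/-- The part of the weights `w` that is carried by the fiber of `f` over `t`. -/
def fiberWeight (f : ι → τ) (w : ι → ℝ) (t : τ) (i : ι) : ℝ := if f i = t then w i else 0

lemma fiberWeight_nonneg {w : ι → ℝ} (hw : ∀ i, 0 ≤ w i) (f : ι → τ) (t : τ) (i : ι) :
    0 ≤ fiberWeight f w t i := by
  unfold fiberWeight
  split_ifs
  exacts [hw i, le_rfl]

variable [Fintype ι]

lemma sum_sum_fiberWeight_smul [Fintype τ] {M : Type*} [AddCommGroup M] [Module ℝ M]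
    (f : ι → τ) (w : ι → ℝ) (x : τ → ι → M) :
    ∑ t, ∑ i, fiberWeight f w t i • x t i = ∑ i, w i • x (f i) i := by
  rw [Finset.sum_comm]
  simp [fiberWeight, ite_smul]

lemma sum_sum_fiberWeight [Fintype τ] (f : ι → τ) (w : ι → ℝ) :
    ∑ t, ∑ i, fiberWeight f w t i = ∑ i, w i := by
  simpa using sum_sum_fiberWeight_smul f w fun _ _ => (1 : ℝ)

end FiberWeight

section Kronecker

variable {ι κ : Type*}

lemma sum_kronecker {α : Type*} [Fintype α] (A : α → Matrix ι ι ℂ) (B : Matrix κ κ ℂ) :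
    (∑ i, A i) ⊗ₖ B = ∑ i, A i ⊗ₖ B := by
  ext x y
  simp only [Matrix.sum_apply, Matrix.kroneckerMap_apply, Finset.sum_mul]

lemma sum_fiberWeight_smul_kronecker_proj {α : Type*} [Fintype α] [Fintype κ] [DecidableEq κ]
    (f : α → κ) (w : α → ℝ) (A : α → Matrix ι ι ℂ) :
    ∑ t, (∑ i, fiberWeight f w t i • A i) ⊗ₖ proj t = ∑ i, w i • (A i ⊗ₖ proj (f i)) := by
  simp only [sum_kronecker, Matrix.smul_kronecker]
  exact sum_sum_fiberWeight_smul f w fun t i => A i ⊗ₖ proj t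

lemma proj_kronecker_proj [DecidableEq ι] [DecidableEq κ] (x : ι) (y : κ) :
    proj x ⊗ₖ proj y = proj (x, y) := by
  simp only [proj, Matrix.single_kronecker_single, mul_one]

lemma trace_proj [Fintype ι] [DecidableEq ι] (x : ι) : (proj x : Matrix ι ι ℂ).trace = 1 := by
  simp [proj]

variable [Fintype ι] [Fintype κ]

lemma conjBy_kronecker (A ρ : Matrix ι ι ℂ) (B τ : Matrix κ κ ℂ) :
    conjBy (A ⊗ₖ B) (ρ ⊗ₖ τ) = conjBy A ρ ⊗ₖ conjBy B τ := by
  simp only [conjBy_apply, Matrix.conjTranspose_kronecker, Matrix.mul_kronecker_mul]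

lemma conjBy_one [DecidableEq ι] (ρ : Matrix ι ι ℂ) : conjBy (1 : Matrix ι ι ℂ) ρ = ρ := by
  simp [conjBy_apply]

lemma conjBy_conjBy {τ : Type*} [Fintype τ] (U : Matrix τ κ ℂ) (W : Matrix κ ι ℂ)
    (ρ : Matrix ι ι ℂ) : conjBy U (conjBy W ρ) = conjBy (U * W) ρ := by
  simp only [conjBy_apply, Matrix.conjTranspose_mul, Matrix.mul_assoc]

lemma conjBy_proj_proj [DecidableEq ι] (x y : ι) :
    conjBy (proj x) (proj y) = if y = x then (proj x : Matrix ι ι ℂ) else 0 := by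
  have h : (proj x : Matrix ι ι ℂ)ᴴ = proj x := by simp [proj]
  rw [conjBy_apply, h]
  split_ifs with hxy
  · subst hxy; simp [proj]
  · simp [proj, Matrix.single_mul_single_of_ne, Ne.symm hxy]

lemma mixture_apply {α : Type*} [Fintype α] (op : α → Matrix ι ι ℂ) (μ : α → ℝ)
    (ρ : Matrix ι ι ℂ) : mixture op μ ρ = ∑ i, μ i • conjBy (op i) ρ := by
  simp [mixture, Complex.coe_smul]

end Kronecker

section Registers

variable {k s a o : ℕ} (ρ : Matrix (Bits k) (Bits k) ℂ) (τ : Matrix (Bits s) (Bits s) ℂ)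

lemma adjoin_kronecker (a₀ : Bits a) :
    adjoin (o := o) a₀ (ρ ⊗ₖ τ) = ρ ⊗ₖ (τ ⊗ₖ (proj a₀ ⊗ₖ proj 0)) := by
  ext x y
  simp [adjoin, Matrix.kroneckerMap_apply, mul_assoc]

lemma discard_kronecker (α : Matrix (Bits a) (Bits a) ℂ) (ω : Matrix (Bits o) (Bits o) ℂ) :
    discard (ρ ⊗ₖ (τ ⊗ₖ (α ⊗ₖ ω))) = (α.trace * ω.trace) • (ρ ⊗ₖ τ) := by
  ext x y
  simp only [discard, LinearMap.coe_mk, AddHom.coe_mk, Matrix.of_apply,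
    Matrix.kroneckerMap_apply, Matrix.smul_apply, smul_eq_mul, Matrix.trace, Matrix.diag_apply]
  rw [Finset.sum_mul_sum]
  simp only [Finset.sum_mul]
  exact Finset.sum_congr rfl fun u _ => Finset.sum_congr rfl fun θ _ => by ring

end Registers

namespace Cycle

variable {k s : ℕ} (c : Cycle k s)

lemma shiftProb_nonneg (r : Bits s) : 0 ≤ c.shiftProb r := by
  unfold shiftProb; split_ifs <;> positivity

lemma sum_shiftProb : ∑ r, c.shiftProb r = 1 := by
  unfold shiftProb
  split_ifs
  · simp [ZMod.card]
  · simp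

/-- The random data of one run of the cycle: the randomizing bitstring and the Pauli error. -/
abbrev Event : Type := Bits s × Pauli k × Pauli s × Pauli c.a × Pauli c.o

/-- The probability of an event. -/
noncomputable def eventProb (i : c.Event) : ℝ := c.shiftProb i.1 * c.noise i.2

lemma eventProb_nonneg (i : c.Event) : 0 ≤ c.eventProb i :=
  mul_nonneg (c.shiftProb_nonneg _) (c.noise_mem.1 _)

lemma sum_eventProb : ∑ i, c.eventProb i = 1 := by
  simp only [eventProb, Fintype.sum_prod_type (α₁ := Bits s)]
  rw [← Fintype.sum_mul_sum, c.sum_shiftProb, c.noise_mem.2, mul_one]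

/-- The joint probability of the event `i` and the transition from `sIn` to `sOut`. -/
noncomputable def weight (sOut sIn : Bits s) : c.Event → ℝ :=
  fiberWeight (fun i => c.outSyndrome sIn i.1 i.2) c.eventProb sOut

lemma weight_nonneg (sOut sIn : Bits s) (i : c.Event) : 0 ≤ c.weight sOut sIn i :=
  fiberWeight_nonneg c.eventProb_nonneg _ _ i

lemma γ_eq_sum_weight (sOut sIn : Bits s) : c.γ sOut sIn = ∑ i, c.weight sOut sIn i :=
  (Fintype.sum_prod_type (c.weight sOut sIn)).symm

lemma γ_nonneg (sOut sIn : Bits s) : 0 ≤ c.γ sOut sIn := by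
  rw [γ_eq_sum_weight]
  exact Finset.sum_nonneg fun i _ => c.weight_nonneg sOut sIn i

lemma sum_γ (sIn : Bits s) : ∑ sOut, c.γ sOut sIn = 1 := by
  simp only [γ_eq_sum_weight, weight, sum_sum_fiberWeight, sum_eventProb]

lemma Λ_eq_centerMass (sOut sIn : Bits s) :
    c.Λ sOut sIn = Finset.univ.centerMass (c.weight sOut sIn) fun i =>
      conjBy (c.cor (c.errSyndrome sIn i.1 i.2 + i.1)).mat ∘ₗ conjBy i.2.1.mat := by
  rw [Finset.centerMass, ← γ_eq_sum_weight, Fintype.sum_prod_type]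
  simp only [Λ, ← Complex.ofReal_inv]
  rfl

lemma γ_smul_Λ (sOut sIn : Bits s) :
    c.γ sOut sIn • c.Λ sOut sIn = ∑ i, c.weight sOut sIn i •
      (conjBy (c.cor (c.errSyndrome sIn i.1 i.2 + i.1)).mat ∘ₗ conjBy i.2.1.mat) := by
  rw [γ_eq_sum_weight, Λ_eq_centerMass, sum_smul_centerMass (c.weight_nonneg sOut sIn)]

lemma conjBy_C_adjoin (r sIn : Bits s) (ρ : Matrix (Bits k) (Bits k) ℂ) :
    conjBy ((1 : Matrix (Bits k) (Bits k) ℂ) ⊗ₖ c.C) (adjoin c.a₀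
      (conjBy ((1 : Matrix (Bits k) (Bits k) ℂ) ⊗ₖ (xPauli r).mat) (ρ ⊗ₖ proj sIn))) =
    ρ ⊗ₖ (proj (sIn + r) ⊗ₖ (proj (c.b (sIn + r)) ⊗ₖ proj (c.E (sIn + r)))) := by
  simp only [conjBy_kronecker, conjBy_one, Pauli.conjBy_proj, Pauli.flip_xPauli,
    adjoin_kronecker, proj_kronecker_proj, c.readout]

lemma discard_feedback (r sIn : Bits s) (θ : Bits c.o)
    (P : Pauli k × Pauli s × Pauli c.a × Pauli c.o) (ρ : Matrix (Bits k) (Bits k) ℂ) :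
    discard (conjBy (c.feedback r θ) (conjBy (pauli4 P)
      (ρ ⊗ₖ (proj (sIn + r) ⊗ₖ (proj (c.b (sIn + r)) ⊗ₖ proj (c.E (sIn + r))))))) =
    if c.E (sIn + r) + P.2.2.2.flip = θ then
      conjBy (c.cor (c.errSyndrome sIn r P + r)).mat (conjBy P.1.mat ρ) ⊗ₖ
        proj (c.outSyndrome sIn r P) else 0 := by
  simp only [pauli4, pauli3, pauli2, feedback, conjBy_kronecker, Pauli.conjBy_proj, conjBy_one,
    Pauli.flip_xPauli, conjBy_proj_proj]
  split_ifs with h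
  · subst h
    simp [discard_kronecker, trace_proj, errSyndrome, outSyndrome, add_assoc]
  · simp

lemma channel_kronecker_proj (sIn : Bits s) (ρ : Matrix (Bits k) (Bits k) ℂ) :
    c.channel (ρ ⊗ₖ proj sIn) = ∑ t, (c.γ t sIn • c.Λ t sIn) ρ ⊗ₖ proj t := by
  calc c.channel (ρ ⊗ₖ proj sIn)
      = ∑ i : c.Event, c.eventProb i •
          (conjBy (c.cor (c.errSyndrome sIn i.1 i.2 + i.1)).mat (conjBy i.2.1.mat ρ) ⊗ₖ
            proj (c.outSyndrome sIn i.1 i.2)) := by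
        simp only [channel, LinearMap.sum_apply, LinearMap.smul_apply, LinearMap.comp_apply,
          Complex.coe_smul, conjBy_C_adjoin, mixture_apply, map_sum, LinearMap.map_smul_of_tower,
          discard_feedback, Fintype.sum_prod_type (α₁ := Bits s), eventProb, mul_smul,
          ← Finset.smul_sum]
        refine Finset.sum_congr rfl fun r _ => ?_
        rw [Finset.sum_comm]
        simp
    _ = ∑ t, (c.γ t sIn • c.Λ t sIn) ρ ⊗ₖ proj t := by
        simp only [γ_smul_Λ, LinearMap.sum_apply, LinearMap.smul_apply, LinearMap.comp_apply,
          weight, sum_fiberWeight_smul_kronecker_proj]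

end Cycle

namespace Preparation

variable {k s : ℕ} (p : Preparation k s)

/-- The joint probability of the error `P` and the syndrome `t`. -/
noncomputable def weight (sStar t : Bits s) : Pauli k × Pauli s → ℝ :=
  fiberWeight (fun P => sStar + P.2.flip) p.noise t

lemma γ_eq_sum_weight (sStar t : Bits s) : p.γ sStar t = ∑ P, p.weight sStar t P := rfl

lemma weight_nonneg (sStar t : Bits s) (P : Pauli k × Pauli s) : 0 ≤ p.weight sStar t P :=
  fiberWeight_nonneg p.noise_mem.1 _ _ P

lemma Λ_eq_centerMass (sStar t : Bits s) :
    p.Λ sStar t = Finset.univ.centerMass (p.weight sStar t) fun P => conjBy P.1.mat := by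
  rw [Finset.centerMass, ← γ_eq_sum_weight]
  simp only [Λ, ← Complex.ofReal_inv]
  rfl

lemma γ_smul_Λ (sStar t : Bits s) :
    p.γ sStar t • p.Λ sStar t = ∑ P, p.weight sStar t P • conjBy P.1.mat := by
  rw [γ_eq_sum_weight, Λ_eq_centerMass, sum_smul_centerMass (p.weight_nonneg sStar t)]

lemma state_eq_sum_kronecker_proj (sStar : Bits s) :
    p.state sStar = ∑ t, (p.γ sStar t • p.Λ sStar t) p.σ ⊗ₖ proj t := by
  simp only [γ_smul_Λ, LinearMap.sum_apply, LinearMap.smul_apply, weight,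
    sum_fiberWeight_smul_kronecker_proj, state, mixture_apply, pauli2, conjBy_kronecker,
    Pauli.conjBy_proj]

end Preparation

/-! ### Measurements and experiments -/

section SingleMatrices

variable {ι κ : Type*} [DecidableEq ι]

lemma star_pi_single_one (i : ι) : star (Pi.single i 1 : ι → ℂ) = Pi.single i 1 := by
  rw [← Pi.single_star, star_one]

variable [Fintype ι]

lemma conjBy_single_of_mulVec [Fintype κ] [DecidableEq κ] {U : Matrix κ ι ℂ} {i j : ι} {i' j' : κ}
    (hi : U *ᵥ Pi.single i 1 = Pi.single i' 1) (hj : U *ᵥ Pi.single j 1 = Pi.single j' 1) :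
    conjBy U (Matrix.single i j 1) = Matrix.single i' j' 1 := by
  simp only [conjBy_apply, Matrix.single_eq_single_vecMulVec_single, Matrix.mul_vecMulVec,
    Matrix.vecMulVec_mul, Matrix.vecMul_conjTranspose, star_pi_single_one, hi, hj]

lemma conjBy_single (i j : ι) (B : Matrix ι ι ℂ) :
    conjBy (Matrix.single i j 1) B = B j j • proj i := by
  simp [conjBy_apply, proj, Matrix.smul_single]

lemma kronecker_proj_eq_sum_single [DecidableEq κ] (B : Matrix ι ι ℂ) (t : κ) :
    B ⊗ₖ proj t = ∑ x, ∑ y, B x y • Matrix.single (x, t) (y, t) (1 : ℂ) := by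
  conv_lhs => rw [Matrix.matrix_eq_sum_single B]
  simp only [sum_kronecker, proj, Matrix.single_kronecker_single, Matrix.smul_single, smul_eq_mul]

end SingleMatrices

lemma trace_mul_mixture {ι n : Type*} [Fintype ι] [Fintype n] {op : ι → Matrix n n ℂ}
    (hop : ∀ i, (op i).IsHermitian) (μ : ι → ℝ) (A ρ : Matrix n n ℂ) :
    (A * mixture op μ ρ).trace = (mixture op μ A * ρ).trace := by
  simp only [mixture_apply, Matrix.mul_sum, Matrix.sum_mul, Matrix.trace_sum, Matrix.mul_smul,
    Matrix.smul_mul, Matrix.trace_smul, conjBy_apply, (hop _).eq]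
  refine Finset.sum_congr rfl fun i _ => ?_
  rw [← Matrix.mul_assoc, Matrix.trace_mul_comm, ← Matrix.mul_assoc, ← Matrix.mul_assoc]

lemma isHermitian_pauli4 {k s a o : ℕ} (P : Pauli k × Pauli s × Pauli a × Pauli o) :
    (pauli4 P).IsHermitian := by
  simp only [Matrix.IsHermitian, pauli4, pauli3, pauli2, Matrix.conjTranspose_kronecker,
    Pauli.conjTranspose_mat]

lemma Pauli.conjBy_mat_one {n : ℕ} (P : Pauli n) : conjBy P.mat 1 = 1 := by
  rw [conjBy_apply, Matrix.mul_one, conjTranspose_mat, mat_mul_self]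

/-- The projector onto the states of `L`, `S`, `A`, `O` with content `θ` of `O`. -/
noncomputable def outcomeProj {k s a o : ℕ} (θ : Bits o) :
    Matrix (Bits k × Bits s × Bits a × Bits o) (Bits k × Bits s × Bits a × Bits o) ℂ :=
  1 ⊗ₖ (1 ⊗ₖ (1 ⊗ₖ proj θ))

lemma conjBy_pauli4_outcomeProj {k s a o : ℕ}
    (P : Pauli k × Pauli s × Pauli a × Pauli o) (θ : Bits o) :
    conjBy (pauli4 P) (outcomeProj θ) = outcomeProj (θ + P.2.2.2.flip) := by
  simp only [outcomeProj, pauli4, pauli3, pauli2, conjBy_kronecker, Pauli.conjBy_mat_one,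
    Pauli.conjBy_proj]

namespace Measurement

variable {k s : ℕ} (m : Measurement k s)

lemma conjTranspose_V_mul : m.Vᴴ * m.V = 1 := Matrix.mem_unitaryGroup_iff'.1 m.V_clifford.1

lemma V_mul_conjTranspose : m.V * m.Vᴴ = 1 := Matrix.mem_unitaryGroup_iff.1 m.V_clifford.1

lemma conjBy_C_adjoin (A : Matrix (Bits k) (Bits k) ℂ) (t : Bits s) :
    conjBy m.C (adjoin m.a₀ (A ⊗ₖ proj t)) =
      ∑ x, ∑ y, (conjBy m.V A) x y •
        Matrix.single (x, t, m.b x t, m.E x t) (y, t, m.b y t, m.E y t) 1 := by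
  have hA : A ⊗ₖ proj (t, m.a₀, (0 : Bits m.o)) =
      conjBy (m.Vᴴ ⊗ₖ 1) (conjBy m.V A ⊗ₖ proj (t, m.a₀, (0 : Bits m.o))) := by
    rw [conjBy_kronecker, conjBy_conjBy, m.conjTranspose_V_mul, conjBy_one, conjBy_one]
  rw [adjoin_kronecker, proj_kronecker_proj, proj_kronecker_proj, hA, conjBy_conjBy,
    kronecker_proj_eq_sum_single]
  simp only [map_sum, map_smul, conjBy_single_of_mulVec (m.readout _ t) (m.readout _ t)]

/-- The probability that the register `O` contains `θ` for the logical basis state `V† |y⟩` and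
the syndrome `t`. -/
noncomputable def readoutProb (t : Bits s) (y : Bits k) (θ : Bits m.o) : ℝ :=
  ∑ P, fiberWeight (fun P => m.E y t + P.2.2.2.flip) m.noise θ P

lemma trace_outcomeProj_mul_single (θ : Bits m.o) (x y : Bits k) (t : Bits s) :
    (outcomeProj θ * Matrix.single (x, t, m.b x t, m.E x t) (y, t, m.b y t, m.E y t) 1).trace =
      if x = y ∧ m.E y t = θ then 1 else 0 := by
  rw [Matrix.trace_mul_single]
  by_cases hxy : x = y
  · subst hxy
    simp [outcomeProj, proj, Matrix.kroneckerMap_apply, Matrix.single_apply, eq_comm]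
  · simp [outcomeProj, hxy, Matrix.kroneckerMap_apply, Ne.symm hxy]

lemma trace_outcomeProj_mul (A : Matrix (Bits k) (Bits k) ℂ) (t : Bits s) (θ : Bits m.o) :
    (outcomeProj θ * mixture pauli4 m.noise (conjBy m.C (adjoin m.a₀ (A ⊗ₖ proj t)))).trace =
      ∑ y, m.readoutProb t y θ * (conjBy m.V A) y y := by
  have hflip (u v : Bits m.o) : u = θ + v ↔ u + v = θ := by
    rw [← ZModModule.sub_eq_add θ v, eq_sub_iff_add_eq]
  rw [trace_mul_mixture isHermitian_pauli4, mixture_apply, conjBy_C_adjoin]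
  simp only [conjBy_pauli4_outcomeProj, Matrix.mul_sum, Matrix.sum_mul, Matrix.trace_sum,
    Matrix.mul_smul, Matrix.smul_mul, Matrix.trace_smul, trace_outcomeProj_mul_single, hflip]
  simp only [ite_and, smul_ite, smul_zero]
  refine Finset.sum_congr rfl fun y _ => ?_
  simp only [Finset.sum_ite_irrel, Finset.sum_const_zero, smul_ite, smul_zero, Finset.sum_ite_eq,
    Finset.mem_univ, if_true, readoutProb, fiberWeight, Complex.ofReal_sum, Finset.sum_mul,
    Finset.smul_sum]
  refine Finset.sum_congr rfl fun P _ => ?_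
  split_ifs <;> simp [mul_comm]

lemma kernel_eq_sum_readoutProb (t : Bits s) (x y : Bits k) :
    m.kernel t x y = ∑ θ, if m.D θ = x then m.readoutProb t y θ else 0 := by
  have h := sum_sum_fiberWeight_smul
    (fun P : Pauli k × Pauli s × Pauli m.a × Pauli m.o => m.E y t + P.2.2.2.flip) m.noise
    fun θ _ => if m.D θ = x then (1 : ℝ) else 0
  simpa [readoutProb, kernel, ← Finset.sum_mul] using h.symm

/-- The effect whose expectation is the probability of the outcome `x` for the syndrome `t`. -/
noncomputable def effect (t : Bits s) (x : Bits k) : Matrix (Bits k) (Bits k) ℂ :=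
  m.Vᴴ * Matrix.diagonal (fun y => (m.kernel t x y : ℂ)) * m.V

lemma isHermitian_effect (t : Bits s) (x : Bits k) : (m.effect t x).IsHermitian := by
  refine Matrix.isHermitian_conjTranspose_mul_mul _ ?_
  simp [Matrix.IsHermitian, Matrix.diagonal_conjTranspose, Pi.star_def]

lemma trace_effect_mul (t : Bits s) (x : Bits k) (A : Matrix (Bits k) (Bits k) ℂ) :
    (m.effect t x * A).trace = ∑ y, m.kernel t x y * (conjBy m.V A) y y := by
  rw [effect, Matrix.mul_assoc, Matrix.mul_assoc, Matrix.trace_mul_comm, Matrix.mul_assoc,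
    ← conjBy_apply]
  simp [Matrix.trace, Matrix.diagonal_mul]

lemma prob_sum_kronecker_proj (A : Bits s → Matrix (Bits k) (Bits k) ℂ) (x : Bits k) :
    m.prob (∑ t, A t ⊗ₖ proj t) x = (∑ t, (m.effect t x * A t).trace).re := by
  have hθ (θ : Bits m.o) : (outcomeProj θ * mixture pauli4 m.noise
      (conjBy m.C (adjoin m.a₀ (∑ t, A t ⊗ₖ proj t)))).trace.re =
      ∑ t, ∑ y, m.readoutProb t y θ * (conjBy m.V (A t) y y).re := by
    simp [Matrix.mul_sum, Matrix.trace_sum, trace_outcomeProj_mul]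
  have hprob : m.prob (∑ t, A t ⊗ₖ proj t) x = ∑ θ, if m.D θ = x then
      ∑ t, ∑ y, m.readoutProb t y θ * (conjBy m.V (A t) y y).re else 0 :=
    Finset.sum_congr rfl fun θ _ => by rw [← hθ]; rfl
  simp only [hprob, trace_effect_mul, kernel_eq_sum_readoutProb, Complex.re_sum,
    Complex.re_ofReal_mul, Finset.sum_mul, ← Finset.sum_filter]
  rw [Finset.sum_comm]
  exact Finset.sum_congr rfl fun t _ => Finset.sum_comm

lemma trace_conjBy_mul_conjBy (A B : Matrix (Bits k) (Bits k) ℂ) :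
    (conjBy m.Vᴴ A * conjBy m.Vᴴ B).trace = (A * B).trace := by
  have hV (C : Matrix (Bits k) (Bits k) ℂ) : m.V * (m.Vᴴ * C) = C := by
    rw [← Matrix.mul_assoc, m.V_mul_conjTranspose, Matrix.one_mul]
  simp only [conjBy_apply, Matrix.conjTranspose_conjTranspose, Matrix.mul_assoc, hV]
  rw [Matrix.trace_mul_comm]
  simp only [Matrix.mul_assoc, m.V_mul_conjTranspose, Matrix.mul_one]

lemma trace_povm_mul_conjBy (x x' y : Bits k) (A : Matrix (Bits k) (Bits k) ℂ) :
    (m.povm x * conjBy (m.Vᴴ * Matrix.single x' y 1 * m.V) A).trace =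
      if x' = x then (conjBy m.V A) y y else 0 := by
  have hpovm : m.povm x = conjBy m.Vᴴ (proj x) := by simp [povm, conjBy_apply]
  rw [hpovm, ← conjBy_conjBy, ← conjBy_conjBy, trace_conjBy_mul_conjBy, conjBy_single,
    Matrix.mul_smul, Matrix.trace_smul]
  simp [proj, Matrix.trace_mul_single, Matrix.single_apply, eq_comm]

lemma trace_povm_mul_Λ (t : Bits s) (x : Bits k) (A : Matrix (Bits k) (Bits k) ℂ) :
    (m.povm x * m.Λ t A).trace = (m.effect t x * A).trace := by
  simp only [trace_effect_mul, Λ, LinearMap.sum_apply, LinearMap.smul_apply, Matrix.mul_sum,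
    Matrix.trace_sum, Matrix.mul_smul, Matrix.trace_smul, trace_povm_mul_conjBy, smul_eq_mul]
  rw [Finset.sum_comm]
  simp

end Measurement

lemma isHermitian_sum_smul {ι n : Type*} [Fintype ι] (w : ι → ℝ) {A : ι → Matrix n n ℂ}
    (hA : ∀ i, (A i).IsHermitian) : (∑ i, w i • A i).IsHermitian := by
  simp only [Matrix.IsHermitian, Matrix.conjTranspose_sum, Matrix.conjTranspose_smul,
    (hA _).eq, star_trivial]

lemma isHermitian_conjBy {m n : Type*} [Fintype m] [Fintype n] (K : Matrix m n ℂ)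
    {ρ : Matrix n n ℂ} (hρ : ρ.IsHermitian) : (conjBy K ρ).IsHermitian :=
  Matrix.isHermitian_mul_mul_conjTranspose K hρ

section Experiment

variable {k s : ℕ} (c : Cycle k s) (p : Preparation k s) (m : Measurement k s)

lemma pathSum_zero (t : Bits s) : pathSum c p 0 t = p.γ c.sStar t • p.Λ c.sStar t := rfl

lemma pathSum_succ (K : ℕ) (t : Bits s) :
    pathSum c p (K + 1) t = ∑ t', (c.γ t t' • c.Λ t t') ∘ₗ pathSum c p K t' := by
  simp only [LinearMap.smul_comp]
  rfl

lemma channel_pow_state (K : ℕ) :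
    (c.channel ^ K) (p.state c.sStar) = ∑ t, pathSum c p K t p.σ ⊗ₖ proj t := by
  induction K with
  | zero => simp only [pow_zero, Module.End.one_apply, p.state_eq_sum_kronecker_proj, pathSum_zero]
  | succ K ih =>
    simp only [pow_succ', Module.End.mul_apply, ih, map_sum, c.channel_kronecker_proj,
      pathSum_succ, LinearMap.sum_apply, LinearMap.comp_apply, sum_kronecker]
    exact Finset.sum_comm

lemma isHermitian_pathSum (K : ℕ) (t : Bits s) : (pathSum c p K t p.σ).IsHermitian := by
  induction K generalizing t with
  | zero =>
    simp only [pathSum_zero, p.γ_smul_Λ, LinearMap.sum_apply, LinearMap.smul_apply]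
    exact isHermitian_sum_smul _ fun P => isHermitian_conjBy _ p.posSemidef.isHermitian
  | succ K ih =>
    simp only [pathSum_succ, c.γ_smul_Λ, LinearMap.sum_apply, LinearMap.smul_apply,
      LinearMap.comp_apply, ← Fintype.sum_prod_type']
    exact isHermitian_sum_smul _ fun i => isHermitian_conjBy _ (isHermitian_conjBy _ (ih _))

lemma trace_povm_mul_Λtot (K : ℕ) (x : Bits k) (A : Matrix (Bits k) (Bits k) ℂ) :
    (m.povm x * Λtot c p m K A).trace = ∑ t, (m.effect t x * pathSum c p K t A).trace := by
  simp only [Λtot, LinearMap.sum_apply, LinearMap.comp_apply, Matrix.mul_sum, Matrix.trace_sum,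
    m.trace_povm_mul_Λ]

theorem experimentProb_eq_trace (K : ℕ) (x : Bits k) :
    (experimentProb c p m K x : ℂ) = (m.povm x * Λtot c p m K p.σ).trace := by
  rw [experimentProb, channel_pow_state, m.prob_sum_kronecker_proj, trace_povm_mul_Λtot,
    ← Complex.conj_eq_iff_re, map_sum]
  exact Finset.sum_congr rfl fun t _ =>
    star_trace_mul_of_isHermitian (m.isHermitian_effect t x) (isHermitian_pathSum c p K t)

end Experiment

/-! ### Eigenvalues of the logical channels -/

namespace Preparation

variable {k s : ℕ} (p : Preparation k s)

/-- The eigenvalues of the conditional logical channel of a preparation in the Pauli basis. -/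
noncomputable def eigenvalue (sStar t : Bits s) : Pauli k → ℝ :=
  Finset.univ.centerMass (p.weight sStar t) fun P => P.1.sgn

lemma Λ_eq_diagonal (sStar t : Bits s) : p.Λ sStar t = Pauli.diagonal (p.eigenvalue sStar t) := by
  rw [Λ_eq_centerMass, eigenvalue, ← AlgHom.toLinearMap_apply, map_centerMass]
  simp only [Pauli.conjBy_mat_eq_diagonal]
  rfl

lemma abs_eigenvalue_le_one (sStar t : Bits s) (Q : Pauli k) : |p.eigenvalue sStar t Q| ≤ 1 :=
  abs_centerMass_apply_le_one (p.weight_nonneg sStar t) fun _ => (abs_character_apply _ Q).le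

end Preparation

namespace Cycle

variable {k s : ℕ} (c : Cycle k s)

/-- The eigenvalues in the Pauli basis of the logical operation that results from the event `i`
and the input syndrome `sIn`. -/
noncomputable def eventSgn (sIn : Bits s) (i : c.Event) : Pauli k →* ℝ :=
  (c.cor (c.errSyndrome sIn i.1 i.2 + i.1)).sgn * i.2.1.sgn

/-- The eigenvalues of `Λ_{s_out, s_in}` in the Pauli basis. -/
noncomputable def eigenvalue (sOut sIn : Bits s) : Pauli k → ℝ :=
  Finset.univ.centerMass (c.weight sOut sIn) fun i => c.eventSgn sIn i

lemma Λ_eq_diagonal (sOut sIn : Bits s) :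
    c.Λ sOut sIn = Pauli.diagonal (c.eigenvalue sOut sIn) := by
  rw [Λ_eq_centerMass, eigenvalue, ← AlgHom.toLinearMap_apply, map_centerMass]
  simp only [Pauli.conjBy_mat_eq_diagonal, ← Module.End.mul_eq_comp, ← map_mul]
  rfl

lemma abs_eigenvalue_le_one (sOut sIn : Bits s) (Q : Pauli k) :
    |c.eigenvalue sOut sIn Q| ≤ 1 :=
  abs_centerMass_apply_le_one (c.weight_nonneg sOut sIn) fun _ => (abs_character_apply _ Q).le

lemma γ_mul_eigenvalue (sOut sIn : Bits s) (Q : Pauli k) :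
    c.γ sOut sIn * c.eigenvalue sOut sIn Q = ∑ i, c.weight sOut sIn i * c.eventSgn sIn i Q := by
  have h := congrFun (sum_smul_centerMass (c.weight_nonneg sOut sIn)
    fun i => ⇑(c.eventSgn sIn i)) Q
  simpa [γ_eq_sum_weight, eigenvalue] using h

lemma marginal_nonneg (t : Bits s) : 0 ≤ c.marginal t := c.γ_nonneg _ _

lemma sum_marginal : ∑ t, c.marginal t = 1 := c.sum_γ _

/-- The eigenvalues of the correction for the true syndrome `t` in the Pauli basis. -/
noncomputable def corSgn (t : Bits s) : Pauli k →* ℝ := (c.cor (t + c.sStar)).sgn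

lemma corSgn_mul_self (t : Bits s) (Q : Pauli k) : c.corSgn t Q * c.corSgn t Q = 1 := by
  rw [← abs_mul_abs_self, abs_character_apply, one_mul]

/-- The eigenvalues of the single-cycle logical error channel in the Pauli basis. -/
noncomputable def eigenvalue₁ : Pauli k → ℝ :=
  ∑ t, ∑ t', (c.marginal t * c.marginal t') • (c.corSgn t * (c.eigenvalue t t' * c.corSgn t'))

lemma Λ₁_eq_diagonal : c.Λ₁ = Pauli.diagonal c.eigenvalue₁ := by
  simp only [Λ₁, Λtilde, corMat, Pauli.conjTranspose_mat, Pauli.conjBy_mat_eq_diagonal,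
    Λ_eq_diagonal, ← Module.End.mul_eq_comp, ← map_mul, eigenvalue₁, map_sum, map_smul]
  rfl

lemma eigenvalue₁_apply (Q : Pauli k) : c.eigenvalue₁ Q = ∑ t, ∑ t',
    c.marginal t * c.marginal t' * (c.corSgn t Q * (c.eigenvalue t t' Q * c.corSgn t' Q)) := by
  simp [eigenvalue₁]

lemma f₁_eq_average_eigenvalue₁ :
    c.f₁ = (Fintype.card (Pauli k) : ℝ)⁻¹ * ∑ Q, c.eigenvalue₁ Q := by
  rw [f₁, Λ₁_eq_diagonal, Pauli.sum_trace_mat_mul_mat_diagonal, Complex.ofReal_re, Pauli.card_eq]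
  push_cast
  rw [show (4 : ℝ) = 2 * 2 by norm_num, mul_pow]
  field_simp

section SyndromeMarginalIndependence

variable {c} (hc : c.SyndromeMarginalIndependence)
include hc

lemma γ_eq_marginal (sOut sIn : Bits s) : c.γ sOut sIn = c.marginal sOut := hc _ _ _

lemma eigenvalue₁_eq_sum_eventProb (Q : Pauli k) :
    c.eigenvalue₁ Q = ∑ j : Bits s × c.Event, c.marginal j.1 * c.eventProb j.2 *
      (c.corSgn (c.outSyndrome j.1 j.2.1 j.2.2) * c.eventSgn j.1 j.2 * c.corSgn j.1) Q := by
  rw [eigenvalue₁_apply, Finset.sum_comm, Fintype.sum_prod_type]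
  refine Finset.sum_congr rfl fun t' _ => ?_
  calc ∑ t, c.marginal t * c.marginal t' *
        (c.corSgn t Q * (c.eigenvalue t t' Q * c.corSgn t' Q))
      = c.marginal t' * c.corSgn t' Q *
          ∑ t, c.corSgn t Q * (c.γ t t' * c.eigenvalue t t' Q) := by
        rw [Finset.mul_sum]
        exact Finset.sum_congr rfl fun t _ => by rw [γ_eq_marginal hc]; ring
    _ = c.marginal t' * c.corSgn t' Q *
          ∑ t, ∑ i, c.weight t t' i • (c.corSgn t Q * c.eventSgn t' i Q) := by
        simp only [γ_mul_eigenvalue, Finset.mul_sum, smul_eq_mul, mul_left_comm]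
    _ = _ := by
        simp only [weight, sum_sum_fiberWeight_smul]
        simp only [Finset.mul_sum, MonoidHom.mul_apply, smul_eq_mul]
        exact Finset.sum_congr rfl fun i _ => by ring

lemma one_sub_eigenvalue₁_le (Q : Pauli k) : 1 - c.eigenvalue₁ Q ≤ 2 * (1 - c.f₁) := by
  have hsum : ∑ j : Bits s × c.Event, c.marginal j.1 * c.eventProb j.2 = 1 := by
    rw [Fintype.sum_prod_type, ← Fintype.sum_mul_sum, c.sum_marginal, c.sum_eventProb, mul_one]
  simp only [f₁_eq_average_eigenvalue₁, eigenvalue₁_eq_sum_eventProb hc]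
  exact one_sub_sum_mul_character_le
    (fun j => mul_nonneg (c.marginal_nonneg _) (c.eventProb_nonneg _)) hsum _ Q

end SyndromeMarginalIndependence

end Cycle

/-! ### The transfer operator -/

lemma norm_toEuclideanCLM_sq_le {ι : Type*} [Fintype ι] [DecidableEq ι] (A : Matrix ι ι ℝ) :
    ‖Matrix.toEuclideanCLM (𝕜 := ℝ) A‖ ^ 2 ≤ ∑ i, ∑ j, A i j ^ 2 := by
  have hA : 0 ≤ ∑ i, ∑ j, A i j ^ 2 := by positivity
  refine (Real.le_sqrt (norm_nonneg _) hA).1 <|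
    ContinuousLinearMap.opNorm_le_bound _ (Real.sqrt_nonneg _) fun x => ?_
  refine le_of_sq_le_sq ?_ (by positivity)
  simp only [mul_pow, Real.sq_sqrt hA, EuclideanSpace.norm_sq_eq, Real.norm_eq_abs, sq_abs,
    Matrix.ofLp_toEuclideanCLM, Matrix.mulVec, dotProduct]
  rw [Finset.sum_mul]
  exact Finset.sum_le_sum fun i _ => Finset.sum_mul_sq_le_sq_mul_sq _ _ _

namespace Cycle

variable {k s : ℕ} (c : Cycle k s)

/-- The transition matrix of the syndromes, symmetrized with respect to the syndrome marginal
distribution, with each entry multiplied by the eigenvalue at `Q` of the channel of the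
transition. -/
noncomputable def transfer (Q : Pauli k) :
    EuclideanSpace ℝ (Bits s) →L[ℝ] EuclideanSpace ℝ (Bits s) :=
  Matrix.toEuclideanCLM (𝕜 := ℝ)
    (Matrix.of fun t t' => √(c.marginal t) * √(c.marginal t') * c.eigenvalue t t' Q)

lemma transfer_apply (Q : Pauli k) (x : EuclideanSpace ℝ (Bits s)) (t : Bits s) :
    c.transfer Q x t =
      ∑ t', √(c.marginal t) * √(c.marginal t') * c.eigenvalue t t' Q * x t' := by
  simp [transfer, Matrix.mulVec, dotProduct]

/-- The unit vector that spans the range of the transfer operator in the absence of logical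
errors. -/
noncomputable def idealVector (Q : Pauli k) : EuclideanSpace ℝ (Bits s) :=
  WithLp.toLp 2 fun t => √(c.marginal t) * c.corSgn t Q

lemma norm_idealVector (Q : Pauli k) : ‖c.idealVector Q‖ = 1 := by
  rw [EuclideanSpace.norm_eq, Real.sqrt_eq_one]
  simp only [idealVector, Real.norm_eq_abs, sq_abs, mul_pow, Real.sq_sqrt (c.marginal_nonneg _)]
  simp only [pow_two, corSgn_mul_self, mul_one, sum_marginal]

lemma transfer_sub_rankOne_idealVector (Q : Pauli k) :
    c.transfer Q - InnerProductSpace.rankOne ℝ (c.idealVector Q) (c.idealVector Q) =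
      Matrix.toEuclideanCLM (𝕜 := ℝ) (Matrix.of fun t t' => √(c.marginal t) * √(c.marginal t') *
        (c.eigenvalue t t' Q - c.corSgn t Q * c.corSgn t' Q)) := by
  ext x t
  simp only [sub_apply, InnerProductSpace.rankOne_apply, PiLp.sub_apply, PiLp.smul_apply,
    transfer_apply, smul_eq_mul, PiLp.inner_apply, idealVector, Finset.sum_mul,
    Matrix.ofLp_toEuclideanCLM, Matrix.mulVec, dotProduct, Matrix.of_apply]
  rw [← Finset.sum_sub_distrib]
  refine Finset.sum_congr rfl fun t' _ => ?_
  simp only [RCLike.inner_apply, conj_trivial]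
  ring

lemma norm_transfer_sub_rankOne_sq_le (Q : Pauli k) :
    ‖c.transfer Q - InnerProductSpace.rankOne ℝ (c.idealVector Q) (c.idealVector Q)‖ ^ 2 ≤
      2 * (1 - c.eigenvalue₁ Q) := by
  have hentry (t t' : Bits s) :
      (√(c.marginal t) * √(c.marginal t') *
        (c.eigenvalue t t' Q - c.corSgn t Q * c.corSgn t' Q)) ^ 2 ≤
      c.marginal t * c.marginal t' *
        (2 - 2 * (c.corSgn t Q * (c.eigenvalue t t' Q * c.corSgn t' Q))) := by
    rw [mul_pow, mul_pow, Real.sq_sqrt (c.marginal_nonneg t), Real.sq_sqrt (c.marginal_nonneg t')]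
    refine mul_le_mul_of_nonneg_left ?_ (mul_nonneg (c.marginal_nonneg t) (c.marginal_nonneg t'))
    have hsgn : (c.corSgn t Q * c.corSgn t' Q) ^ 2 = 1 := by
      rw [mul_pow, pow_two, pow_two, corSgn_mul_self, corSgn_mul_self, one_mul]
    have heig := (sq_le_one_iff_abs_le_one _).2 (c.abs_eigenvalue_le_one t t' Q)
    linarith
  rw [transfer_sub_rankOne_idealVector]
  calc _ ≤ _ := norm_toEuclideanCLM_sq_le _
    _ ≤ _ := Finset.sum_le_sum fun t _ => Finset.sum_le_sum fun t' _ => hentry t t'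
    _ = 2 * (1 - c.eigenvalue₁ Q) := by
        simp only [mul_sub, Finset.sum_sub_distrib, ← Finset.sum_mul, ← Finset.mul_sum,
          mul_left_comm _ (2 : ℝ), sum_marginal, mul_one, one_mul, ← eigenvalue₁_apply]

lemma norm_transfer_sub_rankOne_le (hc : c.SyndromeMarginalIndependence) {ε₁ : ℝ}
    (hf : 1 - ε₁ ≤ c.f₁) (Q : Pauli k) :
    ‖c.transfer Q - InnerProductSpace.rankOne ℝ (c.idealVector Q) (c.idealVector Q)‖ ≤
      2 * √ε₁ := by
  have hsq := c.norm_transfer_sub_rankOne_sq_le Q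
  have hfid := one_sub_eigenvalue₁_le hc Q
  rw [← Real.sqrt_sq zero_le_two, ← Real.sqrt_mul (by positivity)]
  exact Real.le_sqrt_of_sq_le (by linarith)

end Cycle

/-! ### The spectral model -/

section Purity

lemma re_trace_mul_self_le_sq_re_trace {n : Type*} [Fintype n] {A : Matrix n n ℂ}
    (hA : A.PosSemidef) : (A * A).trace.re ≤ A.trace.re ^ 2 := by
  have hminor (i j : n) : (A i j * A j i).re ≤ (A i i).re * (A j j).re := by
    have hdet := (Complex.le_def.1 (hA.submatrix ![i, j]).det_nonneg).1
    have him : (A i i).im = 0 := Complex.conj_eq_iff_im.1 (hA.isHermitian.apply i i)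
    rw [Matrix.det_fin_two] at hdet
    simpa [him] using hdet
  simp only [pow_two, Matrix.trace, Matrix.diag_apply, Matrix.mul_apply, Complex.re_sum,
    Finset.sum_mul_sum]
  exact Finset.sum_le_sum fun i _ => Finset.sum_le_sum fun j _ => hminor i j

variable {k s : ℕ} (p : Preparation k s) (m : Measurement k s)

lemma Preparation.sum_norm_sq_trace_le : ∑ Q : Pauli k, ‖(Q.mat * p.σ).trace‖ ^ 2 ≤ 2 ^ k := by
  have hparseval : ∑ Q : Pauli k, ‖(Q.mat * p.σ).trace‖ ^ 2 = 2 ^ k * (p.σ * p.σ).trace.re := by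
    have h := congrArg Complex.re (Pauli.sum_norm_sq_trace p.posSemidef.isHermitian)
    rwa [Complex.ofReal_re, ← Complex.ofReal_ofNat, ← Complex.ofReal_pow,
      Complex.re_ofReal_mul] at h
  have hpurity := re_trace_mul_self_le_sq_re_trace p.posSemidef
  rw [p.trace_eq_one, Complex.one_re, one_pow] at hpurity
  rw [hparseval]
  exact mul_le_of_le_one_right (by positivity) hpurity

namespace Measurement

lemma kernel_nonneg (t : Bits s) (x y : Bits k) : 0 ≤ m.kernel t x y :=
  Finset.sum_nonneg fun P _ => ite_nonneg (m.noise_mem.1 P) le_rfl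

lemma kernel_le_one (t : Bits s) (x y : Bits k) : m.kernel t x y ≤ 1 := by
  rw [← m.noise_mem.2, kernel, ← Finset.sum_filter]
  exact Finset.sum_le_univ_sum_of_nonneg m.noise_mem.1

lemma trace_effect_mul_self (t : Bits s) (x : Bits k) :
    (m.effect t x * m.effect t x).trace = ((∑ y, m.kernel t x y ^ 2 : ℝ) : ℂ) := by
  have hdiag : conjBy m.V (m.effect t x) = Matrix.diagonal fun y => (m.kernel t x y : ℂ) := by
    simp only [conjBy_apply, effect, ← Matrix.mul_assoc, V_mul_conjTranspose, Matrix.one_mul]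
    simp only [Matrix.mul_assoc, V_mul_conjTranspose, Matrix.mul_one]
  simp [trace_effect_mul, hdiag, pow_two]

lemma sum_norm_sq_trace_effect_le (t : Bits s) (x : Bits k) :
    ∑ Q : Pauli k, ‖(Q.mat * m.effect t x).trace‖ ^ 2 ≤ (2 ^ k) ^ 2 := by
  have hparseval : ∑ Q : Pauli k, ‖(Q.mat * m.effect t x).trace‖ ^ 2 =
      2 ^ k * ∑ y, m.kernel t x y ^ 2 := by
    have h := Pauli.sum_norm_sq_trace (m.isHermitian_effect t x)
    rw [trace_effect_mul_self] at h
    exact_mod_cast h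
  have hkernel : ∑ y, m.kernel t x y ^ 2 ≤ 2 ^ k :=
    calc ∑ y, m.kernel t x y ^ 2 ≤ ∑ _y : Bits k, (1 : ℝ) := Finset.sum_le_sum fun y _ =>
          pow_le_one₀ (m.kernel_nonneg t x y) (m.kernel_le_one t x y)
      _ = 2 ^ k := by simp
  rw [hparseval, pow_two]
  exact mul_le_mul_of_nonneg_left hkernel (by positivity)

end Measurement

end Purity

lemma norm_sum_trace_mul_diagonal_le {n : ℕ} {τ : Type*} [Fintype τ] {γ : τ → ℝ}
    (hγ : γ ∈ stdSimplex ℝ τ) {v : Pauli n → EuclideanSpace ℝ τ} {B : ℝ} (hv : ∀ Q, ‖v Q‖ ≤ B)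
    {M : τ → Matrix (Bits n) (Bits n) ℂ}
    (hM : ∀ t, ∑ Q : Pauli n, ‖(Q.mat * M t).trace‖ ^ 2 ≤ (2 ^ n) ^ 2)
    {ρ : Matrix (Bits n) (Bits n) ℂ} (hρ : ∑ Q : Pauli n, ‖(Q.mat * ρ).trace‖ ^ 2 ≤ 2 ^ n) :
    ‖∑ t, (M t * Pauli.diagonal (fun Q => √(γ t) * v Q t) ρ).trace‖ ≤ B * √(2 ^ n) := by
  have hB : 0 ≤ B := (norm_nonneg _).trans (hv 1)
  have hleft : ∑ j : τ × Pauli n, (‖v j.2 j.1‖ * ‖(j.2.mat * ρ).trace‖) ^ 2 ≤ B ^ 2 * 2 ^ n :=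
    calc _ = ∑ Q : Pauli n, ‖v Q‖ ^ 2 * ‖(Q.mat * ρ).trace‖ ^ 2 := by
          simp only [Fintype.sum_prod_type_right, mul_pow, ← Finset.sum_mul,
            ← EuclideanSpace.norm_sq_eq]
      _ ≤ ∑ Q : Pauli n, B ^ 2 * ‖(Q.mat * ρ).trace‖ ^ 2 :=
          Finset.sum_le_sum fun Q _ => by gcongr; exact hv Q
      _ ≤ B ^ 2 * 2 ^ n := by rw [← Finset.mul_sum]; gcongr
  have hright : ∑ j : τ × Pauli n, (√(γ j.1) * ‖(j.2.mat * M j.1).trace‖) ^ 2 ≤ (2 ^ n) ^ 2 :=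
    calc _ = ∑ t, γ t * ∑ Q : Pauli n, ‖(Q.mat * M t).trace‖ ^ 2 := by
          simp only [Fintype.sum_prod_type (α₁ := τ), mul_pow, Real.sq_sqrt (hγ.1 _),
            ← Finset.mul_sum]
      _ ≤ ∑ t, γ t * (2 ^ n) ^ 2 :=
          Finset.sum_le_sum fun t _ => mul_le_mul_of_nonneg_left (hM t) (hγ.1 t)
      _ = (2 ^ n) ^ 2 := by rw [← Finset.sum_mul, hγ.2, one_mul]
  calc _ = ‖((2 : ℂ) ^ n)⁻¹ * ∑ j : τ × Pauli n, ((√(γ j.1) * v j.2 j.1 : ℝ) : ℂ) *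
          ((j.2.mat * M j.1).trace * (j.2.mat * ρ).trace)‖ := by
        simp only [Pauli.trace_mul_diagonal, ← Finset.mul_sum, Fintype.sum_prod_type (α₁ := τ)]
    _ ≤ (2 ^ n)⁻¹ * ∑ j : τ × Pauli n, (‖v j.2 j.1‖ * ‖(j.2.mat * ρ).trace‖) *
          (√(γ j.1) * ‖(j.2.mat * M j.1).trace‖) := by
        rw [norm_mul, norm_inv, norm_pow, Complex.norm_ofNat]
        gcongr
        refine (norm_sum_le _ _).trans_eq (Finset.sum_congr rfl fun j _ => ?_)
        rw [norm_mul, norm_mul, Complex.norm_real, norm_mul,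
          Real.norm_of_nonneg (Real.sqrt_nonneg _)]
        ring
    _ ≤ (2 ^ n)⁻¹ * (√(B ^ 2 * 2 ^ n) * √((2 ^ n) ^ 2)) := by
        gcongr
        exact (Real.sum_mul_le_sqrt_mul_sqrt _ _ _).trans (by gcongr)
    _ = B * √(2 ^ n) := by
        rw [Real.sqrt_mul (by positivity), Real.sqrt_sq hB, Real.sqrt_sq (by positivity)]
        field_simp

section Model

variable {k s : ℕ} (c : Cycle k s) (p : Preparation k s) (m : Measurement k s)

/-- The vector of the eigenvalues at `Q` of the channels of a preparation, in the coordinates in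
which `Cycle.transfer` is symmetrized: each entry carries the square root of the marginal
probability of its syndrome. -/
noncomputable def prepVector (Q : Pauli k) : EuclideanSpace ℝ (Bits s) :=
  WithLp.toLp 2 fun t => √(c.marginal t) * p.eigenvalue c.sStar t Q

lemma norm_prepVector_le_one (Q : Pauli k) : ‖prepVector c p Q‖ ≤ 1 := by
  rw [EuclideanSpace.norm_eq, Real.sqrt_le_one, ← c.sum_marginal]
  simp only [prepVector, Real.norm_eq_abs, sq_abs, mul_pow, Real.sq_sqrt (c.marginal_nonneg _)]
  exact Finset.sum_le_sum fun t _ => mul_le_of_le_one_right (c.marginal_nonneg t) <|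
    (sq_le_one_iff_abs_le_one _).2 (p.abs_eigenvalue_le_one _ _ _)

section SyndromeMarginalIndependence

variable {c p} (hc : c.SyndromeMarginalIndependence) (hp : ∀ t, p.γ c.sStar t = c.marginal t)
include hc hp

lemma pathSum_eq_diagonal (K : ℕ) (t : Bits s) :
    pathSum c p K t =
      Pauli.diagonal fun Q => √(c.marginal t) * (c.transfer Q ^ K) (prepVector c p Q) t := by
  have hsqrt := fun t => Real.mul_self_sqrt (c.marginal_nonneg t)
  induction K generalizing t with
  | zero =>
    rw [pathSum_zero, hp, p.Λ_eq_diagonal, ← map_smul]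
    congr 1
    ext Q
    simp only [pow_zero, one_apply_eq_self, prepVector, Pi.smul_apply, smul_eq_mul, ← mul_assoc,
      hsqrt]
  | succ K ih =>
    simp only [pathSum_succ, Cycle.γ_eq_marginal hc, c.Λ_eq_diagonal, ih, ← map_smul,
      ← Module.End.mul_eq_comp, ← map_mul, ← map_sum]
    congr 1
    ext Q
    simp only [pow_succ', mul_apply_eq_comp, c.transfer_apply, Finset.mul_sum, Finset.sum_apply,
      Pi.mul_apply, Pi.smul_apply, smul_eq_mul]
    refine Finset.sum_congr rfl fun t' _ => ?_
    nth_rw 1 [← hsqrt t]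
    ring

lemma trace_povm_mul_Λtot_eq_sum_diagonal (K : ℕ) (x : Bits k) :
    (m.povm x * Λtot c p m K p.σ).trace = ∑ t, (m.effect t x * Pauli.diagonal
      (fun Q => √(c.marginal t) * (c.transfer Q ^ K) (prepVector c p Q) t) p.σ).trace := by
  simp only [trace_povm_mul_Λtot, pathSum_eq_diagonal hc hp]

end SyndromeMarginalIndependence

/-- The Markovian model that replaces the powers `T ^ K` of the transfer operator at `Q` by
`μ Q ^ K` times the operator of rank one with factors `r Q` and `l Q`. The preparations apply
`l Q`, the cycle multiplies by `μ Q`, and the measurements average over `r Q`. -/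
noncomputable def spectralModel (μ : Pauli k → ℝ) (r l : Pauli k → EuclideanSpace ℝ (Bits s)) :
    MarkovModel k s where
  prep p := Pauli.diagonal fun Q => inner ℝ (l Q) (prepVector c p Q)
  qec := Pauli.diagonal μ
  meas m := ∑ t, m.Λ t ∘ₗ Pauli.diagonal fun Q => √(c.marginal t) * r Q t

variable (μ : Pauli k → ℝ) (r l : Pauli k → EuclideanSpace ℝ (Bits s))

lemma prediction_spectralModel (K : ℕ) (x : Bits k) :
    (spectralModel c μ r l).prediction p m K x = ∑ t, (m.effect t x * Pauli.diagonal
      (fun Q => √(c.marginal t) * (μ Q ^ K • InnerProductSpace.rankOne ℝ (r Q) (l Q))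
        (prepVector c p Q) t) p.σ).trace := by
  simp only [MarkovModel.prediction, spectralModel, LinearMap.sum_apply, LinearMap.comp_apply,
    Matrix.mul_sum, Matrix.trace_sum, m.trace_povm_mul_Λ]
  refine Finset.sum_congr rfl fun t _ => ?_
  simp only [← Module.End.mul_apply, ← map_pow, ← map_mul]
  congr 4
  ext Q
  simp only [Pi.mul_apply, Pi.pow_apply, smul_apply,
    InnerProductSpace.rankOne_apply, PiLp.smul_apply, smul_eq_mul]
  ring

theorem norm_trace_sub_prediction_spectralModel_le {c p} (hc : c.SyndromeMarginalIndependence)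
    (hp : ∀ t, p.γ c.sStar t = c.marginal t) {K : ℕ} {B : ℝ}
    (hB : ∀ Q, ‖c.transfer Q ^ K - μ Q ^ K • InnerProductSpace.rankOne ℝ (r Q) (l Q)‖ ≤ B)
    (x : Bits k) :
    ‖(m.povm x * Λtot c p m K p.σ).trace - (spectralModel c μ r l).prediction p m K x‖ ≤
      B * √(2 ^ k) := by
  have hv (Q : Pauli k) : ‖(c.transfer Q ^ K - μ Q ^ K • InnerProductSpace.rankOne ℝ (r Q) (l Q))
      (prepVector c p Q)‖ ≤ B :=
    (ContinuousLinearMap.le_of_opNorm_le_of_le _ (hB Q) (norm_prepVector_le_one c p Q)).trans_eq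
      (mul_one B)
  have hbound := norm_sum_trace_mul_diagonal_le ⟨c.marginal_nonneg, c.sum_marginal⟩ hv
    (fun t => m.sum_norm_sq_trace_effect_le t x) p.sum_norm_sq_trace_le
  convert hbound using 2
  rw [trace_povm_mul_Λtot_eq_sum_diagonal m hc hp, prediction_spectralModel,
    ← Finset.sum_sub_distrib]
  refine Finset.sum_congr rfl fun t _ => ?_
  rw [← Matrix.trace_sub, ← Matrix.mul_sub, ← LinearMap.sub_apply, ← map_sub]
  congr 4
  ext Q
  simp only [Pi.sub_apply, sub_apply, PiLp.sub_apply, mul_sub]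

end Model

theorem exists_markovModel_near {k s : ℕ} {c : Cycle k s} (hc : c.SyndromeMarginalIndependence)
    {ε₁ : ℝ} (hε : 2 * (1 + √2) * √ε₁ ≤ 1) (hf : 1 - ε₁ ≤ c.f₁) :
    ∃ M : MarkovModel k s, ∀ (p : Preparation k s) (m : Measurement k s),
      (∀ t, p.γ c.sStar t = c.marginal t) → ∀ (K : ℕ) (x : Bits k),
        ‖(experimentProb c p m K x : ℂ) - M.prediction p m K x‖ ≤
          2 * √(2 ^ k) * (2 * (1 + √2) * √ε₁) ^ K := by
  have hδ : (1 + √2) * (2 * √ε₁) = 2 * (1 + √2) * √ε₁ := by ring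
  have hrankOne := fun Q => exists_rankOne_approx_pow (c.norm_idealVector Q)
    (c.norm_transfer_sub_rankOne_le hc hf Q) (hδ.trans_le hε)
  choose μ r l hμ using hrankOne
  refine ⟨spectralModel c μ r l, fun p m hp K x => ?_⟩
  rw [experimentProb_eq_trace, mul_right_comm, ← hδ]
  exact norm_trace_sub_prediction_spectralModel_le m μ r l hc hp (fun Q => hμ Q K) x

/-! ### The constants -/

section Constants

variable {δ : ℝ}

lemma two_mul_one_add_sqrt_two_mul_lt_one (hδ : δ ≤ 1 / 8) : 2 * (1 + √2) * δ < 1 := by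
  have h2 : √2 < 1.42 := (Real.sqrt_lt' (by norm_num)).2 (by norm_num)
  calc 2 * (1 + √2) * δ ≤ 2 * (1 + √2) * (1 / 8) := by gcongr
    _ < 1 := by linarith

lemma two_mul_one_add_sqrt_two_mul_div_lt (hδ : δ ≤ 1 / 8) :
    2 * (1 + √2) * δ / (1 - 2 * δ) < 5 / 6 := by
  have h2 : √2 < 1.42 := (Real.sqrt_lt' (by norm_num)).2 (by norm_num)
  have h : (2 * (1 + √2) + 5 / 3) * δ ≤ (2 * (1 + √2) + 5 / 3) * (1 / 8) := by gcongr
  rw [div_lt_iff₀ (by linarith)]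
  linarith

lemma one_add_one_div_one_sub_mem_Ico (hδ₀ : 0 ≤ δ) (hδ : δ ≤ 1 / 8) :
    1 + 1 / (1 - 2 * (1 + √2) * δ / (1 - 2 * δ)) ∈ Set.Ico (2 : ℝ) 7 := by
  set q := 2 * (1 + √2) * δ / (1 - 2 * δ)
  have hq₀ : 0 ≤ q := div_nonneg (by positivity) (by linarith)
  have hq : q < 5 / 6 := two_mul_one_add_sqrt_two_mul_div_lt hδ
  have hlower : 1 ≤ 1 / (1 - q) := one_le_one_div (by linarith) (by linarith)
  have hupper : 1 / (1 - q) < 6 := by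
    rw [div_lt_iff₀ (by linarith)]
    linarith
  constructor <;> linarith

end Constants

end QEC

theorem mainTheorem1_general {k s : ℕ} {c : QEC.Cycle k s} (hc : c.SyndromeMarginalIndependence)
    {ε₁ : ℝ} (hε₁ : 0 < ε₁) (hf : 1 - ε₁ ≤ c.f₁)
    {Exp : Set (QEC.Preparation k s × QEC.Measurement k s)}
    (hprep : ∀ e ∈ Exp, ∀ t, e.1.γ c.sStar t = c.marginal t)
    {ε G : ℝ} (hε : ε = 2 * (1 + √2) * √ε₁) (hε1 : ε < 1) (hG : 2 * √(2 ^ k) ≤ G) :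
    ∃ M : QEC.MarkovModel k s, M.IsApprox c Exp G ε ∧ ∀ e ∈ Exp, ∀ (K : ℕ) (x : QEC.Bits k),
      ‖(QEC.experimentProb c e.1 e.2 K x : ℂ) - M.prediction e.1 e.2 K x‖ ≤ G * ε ^ K := by
  subst hε
  obtain ⟨M, hM⟩ := QEC.exists_markovModel_near hc hε1.le hf
  have hprob : ∀ e ∈ Exp, ∀ (K : ℕ) (x : QEC.Bits k),
      ‖(QEC.experimentProb c e.1 e.2 K x : ℂ) - M.prediction e.1 e.2 K x‖ ≤
        G * (2 * (1 + √2) * √ε₁) ^ K :=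
    fun e he K x => (hM e.1 e.2 (hprep e he) K x).trans (by gcongr)
  refine ⟨M, ⟨lt_of_lt_of_le (by positivity) hG, by positivity, hε1, fun e he K _ x => ?_⟩, hprob⟩
  rw [← QEC.experimentProb_eq_trace]
  exact hprob e he K x

theorem mainTheorem1 {k s : ℕ} (c : QEC.Cycle k s)
    (hc : c.SyndromeMarginalIndependence)
    (ε₁ : ℝ) (hε₁ : 0 < ε₁) (hε₁' : ε₁ ≤ 1 / 64) (hf : 1 - ε₁ ≤ c.f₁)
    (Exp : Set (QEC.Preparation k s × QEC.Measurement k s))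
    (hprep : ∀ e ∈ Exp, ∀ t : QEC.Bits s, e.1.γ c.sStar t = c.marginal t)
    (ε G' G : ℝ) (hε : ε = 2 * (1 + √2) * √ε₁)
    (hG' : G' = 1 + 1 / (1 - ε / (1 - 2 * √ε₁)))
    (hG : G = G' * √((2 : ℝ) ^ k)) :
    G' < 7 ∧
      ∃ M : QEC.MarkovModel k s, M.IsApprox c Exp G ε ∧
        ∀ e ∈ Exp, ∀ K : ℕ, 0 < K → ∀ x : QEC.Bits k,
          ‖(QEC.experimentProb c e.1 e.2 K x : ℂ) - M.prediction e.1 e.2 K x‖ ≤ G * ε ^ K := by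
  have hsqrt : √ε₁ ≤ 1 / 8 := Real.sqrt_le_iff.2 ⟨by norm_num, by norm_num; linarith⟩
  have hfactor : G' ∈ Set.Ico 2 7 := by
    rw [hG', hε]
    exact QEC.one_add_one_div_one_sub_mem_Ico (Real.sqrt_nonneg _) hsqrt
  obtain ⟨M, hM, hprob⟩ := mainTheorem1_general hc hε₁ hf hprep hε
    (hε.trans_lt (QEC.two_mul_one_add_sqrt_two_mul_lt_one hsqrt))
    (hG.symm ▸ mul_le_mul_of_nonneg_right hfactor.1 (Real.sqrt_nonneg _))
  exact ⟨hfactor.2, M, hM, fun e he K _ x => hprob e he K x⟩
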